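/- **Setting.** Let $\mathcal Z$ be a measurable space, $\mathcal Z_\bot=\mathcal Z\cup\{\bot\}$, and let $(\Theta,\ell,\mathcal D)$ be a learning task: $\Theta\subseteq\mathbb R^{d}$ ($d\ge 1$), $\ell_\theta:\mathcal Z\to[0,\infty)$ is measurable for each $\theta\in\Theta$, $\ell_\theta(\bot)=0$, and $\mathcal D$ is a probability distribution on $\mathcal Z$. For $S\in\mathcal Z_\bot^n$ let $L_\theta(S)=\frac1n\sum_{i=1}^n\ell_\theta(s_i)$, $L(S)=\inf_{\theta\in\Theta}L_\theta(S)$ and, for $w\in\Theta|_1=\{\theta_1:\theta\in\Theta\}$, $L^{(w)}(S)=\inf_{\theta\in\Theta,\ \theta_1=w}L_\theta(S)$; assume that $Z\mapsto L(Z)$ is $\mathcal D^n$-almost everywhere measurable on $\mathcal Z^n$ for each $n$. Let $\theta(\mathcal D)\in\Theta$ minimize $\theta\mapsto\mathbb E_{z\sim\mathcal D}[\ell_\theta(z)]\in[0,\infty]$ over $\Theta$, and for every $n$ and $Z\in\mathcal Z^n$ let $\theta(Z)\in\Theta$ be a minimizer of $L_\theta(Z)$ over $\Theta$ (minimizers are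 assumed to exist; any choice is allowed). For $Z\in\mathcal Z^n$ let $Z_{-i}\in\mathcal Z_\bot^n$ be $Z$ with $z_i$ replaced by $\bot$. For $p\in(0,1)$, $S\sim\mathcal S_p(Z)$ is obtained by setting, independently for each $i$, $s_i=z_i$ with probability $p$ and $s_i=\bot$ otherwise. **Assumption.** There are $N:(0,\infty)\to[0,\infty)$ and $M,K,\lambda,\mu,\sigma>0$ such that for all $\alpha,\beta>0$: 1. for all $n\ge N(\alpha)+\frac{K\log(1/\beta)}{\alpha^2}$: $\Pr_{Z\sim\mathcal D^n}\big[|\theta(Z)_1-\theta(\mathcal D)_1|\ge\alpha\mu^{-1/2}\big]\le\beta$; 2. for all $n\ge M+K\log(1/\beta)$: with probability at least $1-\beta$ over $Z\sim\mathcal D^n$, for all $w\in\Theta|_1$, $\frac{\mu}{2}(w-\theta(Z)_1)^2\le L^{(w)}(Z)-L(Z)\le2\mu(w-\theta(Z)_1)^2$; 3. for all $n\ge M+K\log(1/\beta)$ and all $i\in\{1,\dots,n\}$: $\Pr_{Z\sim\mathcal D^n}\big[|L(Z)-L(Z_{-i})|\ge\frac{\lambda\log(2/\beta)}{n}\big]\le\beta$;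 4. for all $n\ge1$: $\Pr_{Z\sim\mathcal D^n}\big[L(Z)\ge\sigma^2\big(1+\frac{\log(1/\beta)}{n}\big)\big]\le\beta$. (If an event is not measurable, its probability bound is read as a bound on the outer measure of the exceptional event.) **Lemma.** There is an absolute constant $C>0$ such that the following holds for every learning task satisfying the assumption, all $p\in(0,\frac14)$, $\alpha,\beta>0$, $\rho\ge2\sigma^2+\alpha^2$, and every partition $\Pi$ of $\Theta|_1$ into $\kappa$ nonempty intervals (an interval of $\Theta|_1$ is the intersection of $\Theta|_1$ with a real interval). For $\pi\in\Pi$ put $L^{(\pi)}(S)=\inf_{w\in\pi}L^{(w)}(S)$, $\Delta(\pi,w)=\inf_{w'\in\pi}|w-w'|$ and $\widetilde L^{(\pi)}(S)=\frac1p\,\mathrm{clip}_\rho\big(L^{(\pi)}(S)\big)$, where $\mathrm{clip}_\rho(x)=\max(0,\min(x,\rho))$. There is a function $h:\bigcup_n\mathcal Z^n\to\mathbb R$ such that for every $n$ with $$n\ \ge\ C\left(\frac{N(\alpha/2)+M}{p}+\Big(\frac{K(1+\alpha^2)}{\alpha^2p}+\frac{\rho^2+\lambda^2}{\alpha^4p}\Big)\log\Big(\frac{n\max(\rho\kappa,2)}{\beta}\Big)^{3}\right),$$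 with probability at least $1-\beta$ over $Z\sim\mathcal D^n$ and $S\sim\mathcal S_p(Z)$, the following holds for all $\pi\in\Pi$: - if $\Delta(\pi,\theta(\mathcal D)_1)\ge10\alpha\mu^{-1/2}$, then $\widetilde L^{(\pi)}(S)>h(Z)+3\alpha^2$; - if $\theta(\mathcal D)_1\in\pi$, then $h(Z)<\widetilde L^{(\pi)}(S)<h(Z)+\alpha^2$. -/

import Mathlib

open MeasureTheory

noncomputable section

/-- A learning task `(Θ, ℓ, D)` over the data space `𝒵`: a set `Θ` of parameters in `ℝ^(d+1)`
(so that there is a first coordinate, with index `0`), a nonnegative measurable loss function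
`ℓ θ` for every `θ ∈ Θ`, and a data-generating probability distribution `D`. -/
structure LearningTask (𝒵 : Type*) [MeasurableSpace 𝒵] (d : ℕ) where
  /-- the parameter set -/
  Θ : Set (Fin (d + 1) → ℝ)
  /-- the losses on data points -/
  ℓ : (Fin (d + 1) → ℝ) → 𝒵 → ℝ
  /-- the data distribution -/
  D : Measure 𝒵
  isProbabilityMeasure_D : IsProbabilityMeasure D
  ℓ_nonneg : ∀ θ ∈ Θ, ∀ z, 0 ≤ ℓ θ z
  ℓ_measurable : ∀ θ ∈ Θ, Measurable (ℓ θ)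

namespace LearningTask

variable {𝒵 : Type*} [MeasurableSpace 𝒵] {d : ℕ} (T : LearningTask 𝒵 d)

/-- The loss on `𝒵 ∪ {⊥}`, where `⊥` is `none`: it vanishes at `⊥`. -/
def lossBot (θ : Fin (d + 1) → ℝ) : Option 𝒵 → ℝ
  | none => 0
  | some z => T.ℓ θ z

/-- The empirical loss `L_θ(S) = (1/n) ∑ᵢ ℓ_θ(sᵢ)` of a dataset `S` of length `n` over
`𝒵 ∪ {⊥}`; the normalization counts the entries equal to `⊥`. -/
def empLoss (θ : Fin (d + 1) → ℝ) {n : ℕ} (S : Fin n → Option 𝒵) : ℝ :=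
  (1 / (n : ℝ)) * ∑ i, T.lossBot θ (S i)

/-- The smallest empirical loss `L(S)`, the minimum of `L_θ(S)` over `θ ∈ Θ`. -/
def minLoss {n : ℕ} (S : Fin n → Option 𝒵) : ℝ :=
  sInf ((fun θ => T.empLoss θ S) '' T.Θ)

/-- `Θ|₁`, the set of first coordinates of the parameters. -/
def firstCoords : Set ℝ := {w | ∃ θ ∈ T.Θ, θ 0 = w}

/-- `L^(w)(S)`, the smallest empirical loss among parameters with first coordinate `w`
(meaningful for `w ∈ Θ|₁`). -/
def minLossAt (w : ℝ) {n : ℕ} (S : Fin n → Option 𝒵) : ℝ :=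
  sInf ((fun θ => T.empLoss θ S) '' {θ | θ ∈ T.Θ ∧ θ 0 = w})

/-- `L^(π)(S)`, the minimum of `L^(w)(S)` over `w ∈ π`
(meaningful for nonempty `π ⊆ Θ|₁`). -/
def minLossOn (π : Set ℝ) {n : ℕ} (S : Fin n → Option 𝒵) : ℝ :=
  sInf ((fun w => T.minLossAt w S) '' π)

/-- The clipped normalized loss `(1/p) · clip_ρ[L^(π)]`, where `clip_ρ` clips to `[0, ρ]`. -/
def clippedLossOn (p ρ : ℝ) (π : Set ℝ) {n : ℕ} (S : Fin n → Option 𝒵) : ℝ :=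
  (1 / p) * max 0 (min (T.minLossOn π S) ρ)

/-- The expected population loss `L_θ(D)`, with values in `[0, ∞]`. -/
def popLoss (θ : Fin (d + 1) → ℝ) : ENNReal :=
  ∫⁻ z, ENNReal.ofReal (T.ℓ θ z) ∂T.D

/-- `θD` is a population minimizer `θ(D)`. -/
def IsPopMinimizer (θD : Fin (d + 1) → ℝ) : Prop :=
  θD ∈ T.Θ ∧ IsMinOn T.popLoss T.Θ θD

/-- A dataset over `𝒵`, as a dataset over `𝒵 ∪ {⊥}`. -/
def full {n : ℕ} (Z : Fin n → 𝒵) : Fin n → Option 𝒵 := fun i => some (Z i)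

/-- `Z₋ᵢ`: the dataset `Z` with its `i`-th element removed, that is, replaced by `⊥`. -/
def remove {n : ℕ} (Z : Fin n → 𝒵) (i : Fin n) : Fin n → Option 𝒵 :=
  Function.update (full Z) i none

/-- `θhat` selects for every dataset `Z` an empirical minimizer `θ(Z)`. -/
def IsEmpMinimizer (θhat : (n : ℕ) → (Fin n → 𝒵) → (Fin (d + 1) → ℝ)) : Prop :=
  ∀ (n : ℕ) (Z : Fin n → 𝒵),
    θhat n Z ∈ T.Θ ∧ IsMinOn (fun θ => T.empLoss θ (full Z)) T.Θ (θhat n Z)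

/-- The law `D^n` of `n` i.i.d. samples. -/
def sampleLaw (n : ℕ) : Measure (Fin n → 𝒵) := Measure.pi fun _ => T.D

/-- The identifiability, concentration and stability conditions with sample sizes `N`, `M` and
constants `K`, `lam`, `μ`, `σ`. Every probability bound is an upper bound on the (outer) measure
of the exceptional event, so that no measurability of the events is presupposed. -/
structure IdentConcStab (θhat : (n : ℕ) → (Fin n → 𝒵) → (Fin (d + 1) → ℝ))
    (θD : Fin (d + 1) → ℝ) (N : ℝ → ℝ) (M K lam μ σ : ℝ) : Prop where
  N_nonneg : ∀ α, 0 < α → 0 ≤ N α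
  M_pos : 0 < M
  K_pos : 0 < K
  lam_pos : 0 < lam
  μ_pos : 0 < μ
  σ_pos : 0 < σ
  /-- concentration of the first coordinate of the empirical minimizer -/
  param_concentration : ∀ α β : ℝ, 0 < α → 0 < β → ∀ n : ℕ,
    N α + K * Real.log (1 / β) / α ^ 2 ≤ (n : ℝ) →
    T.sampleLaw n {Z | α / √μ ≤ |θhat n Z 0 - θD 0|} ≤ ENNReal.ofReal β
  /-- typical smoothness and strong convexity in the first coordinate -/
  identifiability : ∀ β : ℝ, 0 < β → ∀ n : ℕ, M + K * Real.log (1 / β) ≤ (n : ℝ) →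
    T.sampleLaw n {Z | ¬ ∀ w ∈ T.firstCoords,
      μ * (w - θhat n Z 0) ^ 2 / 2 ≤ T.minLossAt w (full Z) - T.minLoss (full Z) ∧
      T.minLossAt w (full Z) - T.minLoss (full Z) ≤ 2 * μ * (w - θhat n Z 0) ^ 2}
      ≤ ENNReal.ofReal β
  /-- stability under removal of one data point -/
  stability : ∀ β : ℝ, 0 < β → ∀ n : ℕ, M + K * Real.log (1 / β) ≤ (n : ℝ) → ∀ i : Fin n,
    T.sampleLaw n {Z | lam * Real.log (2 / β) / n
      ≤ |T.minLoss (full Z) - T.minLoss (remove Z i)|} ≤ ENNReal.ofReal β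
  /-- upper tail of the smallest empirical loss -/
  tail_bound : ∀ β : ℝ, 0 < β → ∀ n : ℕ, 1 ≤ n →
    T.sampleLaw n {Z | σ ^ 2 * (1 + Real.log (1 / β) / n) ≤ T.minLoss (full Z)}
      ≤ ENNReal.ofReal β

/-- `π` is a partition of `A` into `κ` nonempty intervals; an interval of `A` is the trace on `A`
of a real interval. -/
structure IsIntervalPartition (A : Set ℝ) {κ : ℕ} (π : Fin κ → Set ℝ) : Prop where
  nonempty : ∀ j, (π j).Nonempty
  interval : ∀ j, ∃ J : Set ℝ, J.OrdConnected ∧ π j = J ∩ A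
  disjoint : Pairwise fun j k => Disjoint (π j) (π k)
  cover : ⋃ j, π j = A

/-- The Bernoulli distribution on `Bool`, `true` having probability `p`. -/
def bern (p : ℝ) : Measure Bool :=
  ENNReal.ofReal p • Measure.dirac true + ENNReal.ofReal (1 - p) • Measure.dirac false

/-- The subsample of `Z` that keeps `zᵢ` where `b i` is `true` and has `⊥` elsewhere. -/
def subsample {n : ℕ} (Z : Fin n → 𝒵) (b : Fin n → Bool) : Fin n → Option 𝒵 :=
  fun i => if b i then some (Z i) else none

/-- The joint law of `Z ∼ D^n` and an independent vector `b` of `n` i.i.d. Bernoulli(`p`) bits;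
under it `(Z, subsample Z b)` is distributed as `Z ∼ D^n`, `S ∼ S_p(Z)`. -/
def subsampleLaw (p : ℝ) (n : ℕ) : Measure ((Fin n → 𝒵) × (Fin n → Bool)) :=
  (T.sampleLaw n).prod (Measure.pi fun _ => bern p)

end LearningTask

end

open MeasureTheory ProbabilityTheory

noncomputable section

/-! Condition on which points are kept. They are m i.i.d. samples Z', where m is within O(√(XΛ)) of
X = pn by a Chernoff bound and Λ is the logarithm in the sample size condition. Every loss of the
subsample is m/n times the loss of Z'. With high probability θ(Z')₁ is within α/(2√μ) of θ(D)₁ and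
the loss grows quadratically around θ(Z')₁. So after division by p, an interval containing θ(D)₁ has
loss at most a fraction of α² above m L(Z')/X, while a distant one lies at least 40α² above it
(`clippedLossOn_subsample_of_typical`). It remains to show that m L(Z') is within α²X/10 of a number
that depends neither on the data nor on the bits; h is this number divided by X, shifted down by
α²/5.

Stability controls the effect of removing a point only with high probability, so a bounded
differences inequality does not apply. It does give increments of m L an exponential tail, valid up
to a level limited by m; truncating m L at ρn controls what lies beyond. The increments thus have
the moments of an exponential variable (`integral_pow_le_of_tail`). Averaging out one coordinate at
a time, with a Taylor bound for the 2q-th power whose linear term vanishes by centring, passes from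
increments to the deviation from the mean (`integral_pow_sub_mean_le`). Markov's inequality with q ≈
Λ gives deviations of order L √m q^(3/2), with L = ρ + λ (`measure_abs_sub_mean_ge_le`); this is the
source of the cubed logarithm. Finally the mean moves by at most 3L per sample, so the random m may
be replaced by ⌈pn⌉ (`IdentConcStab.abs_meanTruncLoss_sub_le`). -/

/-! ### Integration of bounded functions over product measures. -/

theorem integrable_of_measurable_of_abs_le {X : Type*} [MeasurableSpace X] {μ : Measure X}
    [IsFiniteMeasure μ] {φ : X → ℝ} (hφ : Measurable φ) {B : ℝ} (hB : ∀ x, |φ x| ≤ B) :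
    Integrable φ μ :=
  Integrable.of_bound hφ.aestronglyMeasurable B (Filter.Eventually.of_forall hB)

theorem abs_integral_le_of_abs_le {X : Type*} [MeasurableSpace X] {μ : Measure X}
    [IsProbabilityMeasure μ] {φ : X → ℝ} {B : ℝ} (hB : ∀ x, |φ x| ≤ B) :
    |∫ x, φ x ∂μ| ≤ B := by
  simpa using norm_integral_le_of_norm_le_const (μ := μ) (f := φ) (C := B)
    (Filter.Eventually.of_forall hB)

/-- Jensen's inequality for even powers. -/
theorem integral_pow_even_le {X : Type*} [MeasurableSpace X] {μ : Measure X}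
    [IsProbabilityMeasure μ] {φ : X → ℝ} (hφ : Measurable φ) {B : ℝ} (hB : ∀ x, |φ x| ≤ B)
    (k : ℕ) : (∫ x, φ x ∂μ) ^ (2 * k) ≤ ∫ x, φ x ^ (2 * k) ∂μ := by
  refine (Even.convexOn_pow (𝕜 := ℝ) (even_two_mul k)).map_integral_le
    (continuous_pow _).continuousOn isClosed_univ (by simp)
    (integrable_of_measurable_of_abs_le hφ hB) ?_
  refine integrable_of_measurable_of_abs_le (B := B ^ (2 * k)) (hφ.pow_const _) fun x => ?_
  simp only [Function.comp, abs_pow]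
  exact pow_le_pow_left₀ (abs_nonneg _) (hB x) _

theorem integral_pi_succ {X : Type*} [MeasurableSpace X] (ν : Measure X)
    [IsProbabilityMeasure ν] {m : ℕ} {φ : (Fin (m + 1) → X) → ℝ} (hφ : Measurable φ) {B : ℝ}
    (hB : ∀ z, |φ z| ≤ B) :
    ∫ z, φ z ∂(Measure.pi fun _ : Fin (m + 1) => ν)
      = ∫ z, ∫ x, φ (Fin.cons x z) ∂ν ∂(Measure.pi fun _ : Fin m => ν) := by
  have h := measurePreserving_piFinSuccAbove (fun _ : Fin (m + 1) => ν) 0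
  have h2 := h.symm.integral_comp (MeasurableEquiv.measurableEmbedding _) φ
  rw [← h2]
  have hc : Measurable fun w : X × (Fin m → X) =>
      φ ((MeasurableEquiv.piFinSuccAbove (fun _ : Fin (m + 1) => X) 0).symm w) :=
    hφ.comp (MeasurableEquiv.measurable _)
  rw [integral_prod_symm _ (integrable_of_measurable_of_abs_le hc fun x => hB _)]
  simp [MeasurableEquiv.piFinSuccAbove, Fin.insertNthEquiv]

theorem measurable_fin_cons {X : Type*} [MeasurableSpace X] {m : ℕ} :
    Measurable fun w : X × (Fin m → X) => (Fin.cons w.1 w.2 : Fin (m + 1) → X) := by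
  rw [measurable_pi_iff]
  intro i
  refine Fin.cases ?_ (fun j => ?_) i
  · simpa using measurable_fst
  · simpa [Function.comp_def] using (measurable_pi_apply j).comp measurable_snd

theorem measurable_integral_right {X Y : Type*} [MeasurableSpace X] [MeasurableSpace Y]
    {ν : Measure Y} [SFinite ν] {φ : X → Y → ℝ} (hφ : Measurable (Function.uncurry φ)) :
    Measurable fun x => ∫ y, φ x y ∂ν :=
  (StronglyMeasurable.integral_prod_right (f := φ) hφ.stronglyMeasurable).measurable

/-! ### A Burkholder-type moment inequality by induction on coordinates. -/

/-- Moments of a function of independent variables, from the moments of its increments under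
resampling of one variable. The pointwise inequality is the Taylor bound behind Burkholder's
inequality. -/
theorem integral_pow_sub_mean_le {X : Type*} [MeasurableSpace X] (ν : Measure X)
    [IsProbabilityMeasure ν] {k : ℕ} (hk : 0 < k) {c A W : ℝ} (hc : 0 ≤ c) (hA : 0 ≤ A)
    (hpt : ∀ x y : ℝ, (x + y) ^ (2 * k)
      ≤ (1 + c) * x ^ (2 * k) + 2 * k * x ^ (2 * k - 1) * y + A * y ^ (2 * k)) {B : ℝ} :
    ∀ (m : ℕ) (f : (Fin m → X) → ℝ), Measurable f → (∀ z, |f z| ≤ B) →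
      (∀ i, ∫ z, ∫ x, (f z - f (Function.update z i x)) ^ (2 * k) ∂ν
        ∂(Measure.pi fun _ : Fin m => ν) ≤ W) →
      ∫ z, (f z - ∫ z', f z' ∂(Measure.pi fun _ : Fin m => ν)) ^ (2 * k)
        ∂(Measure.pi fun _ : Fin m => ν) ≤ (1 + c) ^ m * m * A * W := by
  intro m
  induction m with
  | zero =>
    intro f _ _ _
    have h0 : ∀ z, f z = f ![] := fun z => congrArg f (Subsingleton.elim _ _)
    simp [h0, hk.ne']
  | succ m ih =>
    intro f hf hB hW
    set P := Measure.pi fun _ : Fin m => ν with hP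
    set E := ∫ z', f z' ∂(Measure.pi fun _ : Fin (m + 1) => ν) with hE
    have hB0 : 0 ≤ B := by
      obtain ⟨x⟩ : Nonempty X := ν.nonempty_of_neZero
      exact (abs_nonneg _).trans (hB fun _ => x)
    have hEB : |E| ≤ B := abs_integral_le_of_abs_le hB
    have hfc : Measurable fun w : X × (Fin m → X) => f (Fin.cons w.1 w.2) :=
      hf.comp measurable_fin_cons
    have hfz : ∀ z : Fin m → X, Measurable fun x => f (Fin.cons x z) := fun z =>
      hfc.comp (measurable_id.prodMk measurable_const)
    set G : (Fin m → X) → ℝ := fun z => ∫ x, f (Fin.cons x z) ∂ν with hG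
    have hGm : Measurable G :=
      measurable_integral_right (φ := fun z x => f (Fin.cons x z)) (hfc.comp measurable_swap)
    have hGB : ∀ z, |G z| ≤ B := fun z => abs_integral_le_of_abs_le fun x => hB _
    have hEG : E = ∫ z, G z ∂P := integral_pi_succ ν hf hB
    have bd : ∀ {a b : ℝ}, |a| ≤ B → |b| ≤ B → ∀ j : ℕ, |(a - b) ^ j| ≤ (2 * B) ^ j := by
      intro a b ha hb j
      rw [abs_pow]
      exact pow_le_pow_left₀ (abs_nonneg _) ((abs_sub _ _).trans (by linarith)) _
    have hW0 : 0 ≤ W := le_trans (integral_nonneg fun z => integral_nonneg fun x =>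
      (even_two_mul k).pow_nonneg _) (hW 0)
    -- the contribution of the first coordinate
    have h1 : ∫ z, ∫ x, (f (Fin.cons x z) - G z) ^ (2 * k) ∂ν ∂P ≤ W := by
      refine le_trans ?_ (hW 0)
      have hm : Measurable fun w : (Fin (m + 1) → X) × X =>
          (f w.1 - f (Function.update w.1 0 w.2)) ^ (2 * k) :=
        ((hf.comp measurable_fst).sub (hf.comp measurable_update')).pow_const _
      rw [integral_pi_succ (B := (2 * B) ^ (2 * k)) ν (measurable_integral_right
        (φ := fun z x => (f z - f (Function.update z 0 x)) ^ (2 * k)) hm)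
        fun z => abs_integral_le_of_abs_le fun x => bd (hB _) (hB _) _]
      have hm3 : Measurable fun w : ((Fin m → X) × X) × X =>
          (f (Fin.cons w.1.2 w.1.1) - f (Fin.cons w.2 w.1.1)) ^ (2 * k) :=
        ((hfc.comp (measurable_swap.comp measurable_fst)).sub
          (hfc.comp (measurable_snd.prodMk (measurable_fst.comp measurable_fst)))).pow_const _
      have hm2 : Measurable fun w : (Fin m → X) × X =>
          ∫ x', (f (Fin.cons w.2 w.1) - f (Fin.cons x' w.1)) ^ (2 * k) ∂ν :=
        measurable_integral_right
          (φ := fun (w : (Fin m → X) × X) x' =>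
            (f (Fin.cons w.2 w.1) - f (Fin.cons x' w.1)) ^ (2 * k)) hm3
      have hm2' : Measurable fun w : (Fin m → X) × X => (f (Fin.cons w.2 w.1) - G w.1) ^ (2 * k) :=
        ((hfc.comp measurable_swap).sub (hGm.comp measurable_fst)).pow_const _
      simp only [Fin.update_cons_zero]
      refine integral_mono
        (integrable_of_measurable_of_abs_le (B := (2 * B) ^ (2 * k)) (measurable_integral_right
          (φ := fun z x => (f (Fin.cons x z) - G z) ^ (2 * k)) hm2') fun z =>
            abs_integral_le_of_abs_le fun x => bd (hB _) (hGB _) _)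
        (integrable_of_measurable_of_abs_le (B := (2 * B) ^ (2 * k)) (measurable_integral_right
          (φ := fun z x => ∫ x', (f (Fin.cons x z) - f (Fin.cons x' z)) ^ (2 * k) ∂ν) hm2)
          fun z => abs_integral_le_of_abs_le fun x =>
            abs_integral_le_of_abs_le fun x' => bd (hB _) (hB _) _) fun z => ?_
      refine integral_mono
        (integrable_of_measurable_of_abs_le (B := (2 * B) ^ (2 * k))
          (((hfz z).sub_const _).pow_const _) fun x => bd (hB _) (hGB _) _)
        (integrable_of_measurable_of_abs_le (B := (2 * B) ^ (2 * k))
          (hm2.comp (measurable_const.prodMk measurable_id))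
          fun x => abs_integral_le_of_abs_le fun x' => bd (hB _) (hB _) _) fun x => ?_
      -- The centred value is an average over an independent copy x', so Jensen bounds its even
      -- power by that of the resampled increment.
      have : f (Fin.cons x z) - G z = ∫ x', (f (Fin.cons x z) - f (Fin.cons x' z)) ∂ν := by
        rw [integral_sub (integrable_const _)
          (integrable_of_measurable_of_abs_le (hfz z) fun x => hB _)]
        simp [hG]
      simp only [this]
      exact integral_pow_even_le (B := 2 * B) (measurable_const.sub (hfz z))
        (fun x' => by simpa using bd (hB (Fin.cons x z)) (hB (Fin.cons x' z)) 1) k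
    -- the averaged function satisfies the hypotheses
    have h2 : ∫ z, (G z - E) ^ (2 * k) ∂P ≤ (1 + c) ^ m * m * A * W := by
      rw [hEG]
      refine ih G hGm hGB fun i => le_trans ?_ (hW i.succ)
      have hm : Measurable fun w : (Fin (m + 1) → X) × X =>
          (f w.1 - f (Function.update w.1 i.succ w.2)) ^ (2 * k) :=
        ((hf.comp measurable_fst).sub (hf.comp measurable_update')).pow_const _
      rw [integral_pi_succ (B := (2 * B) ^ (2 * k)) ν (measurable_integral_right
        (φ := fun z x => (f z - f (Function.update z i.succ x)) ^ (2 * k)) hm)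
        fun z => abs_integral_le_of_abs_le fun x => bd (hB _) (hB _) _]
      simp only [← Fin.cons_update]
      have hm3 : Measurable fun w : ((Fin m → X) × X) × X =>
          (f (Fin.cons w.2 w.1.1) - f (Fin.cons w.2 (Function.update w.1.1 i w.1.2))) ^ (2 * k) :=
        ((hfc.comp (measurable_snd.prodMk (measurable_fst.comp measurable_fst))).sub
          (hfc.comp (measurable_snd.prodMk (measurable_update'.comp measurable_fst)))).pow_const _
      have hm2 : Measurable fun w : (Fin m → X) × X =>
          ∫ x, (f (Fin.cons x w.1) - f (Fin.cons x (Function.update w.1 i w.2))) ^ (2 * k) ∂ν :=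
        measurable_integral_right
          (φ := fun (w : (Fin m → X) × X) x =>
            (f (Fin.cons x w.1) - f (Fin.cons x (Function.update w.1 i w.2))) ^ (2 * k)) hm3
      have hm2' : Measurable fun w : (Fin m → X) × X =>
          (G w.1 - G (Function.update w.1 i w.2)) ^ (2 * k) :=
        ((hGm.comp measurable_fst).sub (hGm.comp measurable_update')).pow_const _
      -- With the average over the first coordinate innermost, Jensen applies to the increments of
      -- `G`.
      have hsw : ∀ z : Fin m → X,
          ∫ x, ∫ y, (f (Fin.cons x z) - f (Fin.cons x (Function.update z i y))) ^ (2 * k) ∂ν ∂ν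
          = ∫ y, ∫ x, (f (Fin.cons x z) - f (Fin.cons x (Function.update z i y))) ^ (2 * k)
            ∂ν ∂ν := fun z => by
        refine integral_integral_swap (integrable_of_measurable_of_abs_le (B := (2 * B) ^ (2 * k))
          (hm3.comp ((measurable_const (a := z)).prodMk measurable_snd |>.prodMk measurable_fst))
          fun x => bd (hB _) (hB _) _)
      simp only [hsw]
      refine integral_mono
        (integrable_of_measurable_of_abs_le (B := (2 * B) ^ (2 * k)) (measurable_integral_right
          (φ := fun z y => (G z - G (Function.update z i y)) ^ (2 * k)) hm2') fun z =>
            abs_integral_le_of_abs_le fun x => bd (hGB _) (hGB _) _)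
        (integrable_of_measurable_of_abs_le (B := (2 * B) ^ (2 * k)) (measurable_integral_right
          (φ := fun z y => ∫ x, (f (Fin.cons x z) -
            f (Fin.cons x (Function.update z i y))) ^ (2 * k) ∂ν) hm2)
          fun z => abs_integral_le_of_abs_le fun x =>
            abs_integral_le_of_abs_le fun x' => bd (hB _) (hB _) _) fun z => ?_
      refine integral_mono
        (integrable_of_measurable_of_abs_le (B := (2 * B) ^ (2 * k))
          (hm2'.comp (measurable_const.prodMk measurable_id)) fun x => bd (hGB _) (hGB _) _)
        (integrable_of_measurable_of_abs_le (B := (2 * B) ^ (2 * k))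
          (hm2.comp (measurable_const.prodMk measurable_id))
          fun x => abs_integral_le_of_abs_le fun x' => bd (hB _) (hB _) _) fun y => ?_
      have : G z - G (Function.update z i y)
          = ∫ x, (f (Fin.cons x z) - f (Fin.cons x (Function.update z i y))) ∂ν := by
        rw [integral_sub (integrable_of_measurable_of_abs_le (hfz _) fun x => hB _)
          (integrable_of_measurable_of_abs_le (hfz _) fun x => hB _)]
      simp only [this]
      exact integral_pow_even_le (B := 2 * B) ((hfz z).sub (hfz _))
        (fun x' => by simpa only [pow_one, Pi.sub_apply] using bd (hB (Fin.cons x' z)) (hB (Fin.cons x' (Function.update z i y))) 1) k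
    -- the one-step inequality
    have h3 : ∫ z, (f z - E) ^ (2 * k) ∂(Measure.pi fun _ : Fin (m + 1) => ν)
        ≤ (1 + c) * ∫ z, (G z - E) ^ (2 * k) ∂P
          + A * ∫ z, ∫ x, (f (Fin.cons x z) - G z) ^ (2 * k) ∂ν ∂P := by
      rw [integral_pi_succ (B := (2 * B) ^ (2 * k)) ν ((hf.sub_const _).pow_const _)
        fun z => bd (hB _) hEB _]
      have hm2' : Measurable fun w : (Fin m → X) × X => (f (Fin.cons w.2 w.1) - G w.1) ^ (2 * k) :=
        ((hfc.comp measurable_swap).sub (hGm.comp measurable_fst)).pow_const _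
      have i1 : Integrable (fun z => (G z - E) ^ (2 * k)) P :=
        integrable_of_measurable_of_abs_le (B := (2 * B) ^ (2 * k))
          ((hGm.sub_const _).pow_const _) fun z => bd (hGB _) hEB _
      have i2 : Integrable (fun z => ∫ x, (f (Fin.cons x z) - G z) ^ (2 * k) ∂ν) P :=
        integrable_of_measurable_of_abs_le (B := (2 * B) ^ (2 * k)) (measurable_integral_right
          (φ := fun z x => (f (Fin.cons x z) - G z) ^ (2 * k)) hm2') fun z =>
            abs_integral_le_of_abs_le fun x => bd (hB _) (hGB _) _
      rw [← integral_const_mul, ← integral_const_mul,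
        ← integral_add (i1.const_mul _) (i2.const_mul _)]
      have hm4 : Measurable fun w : (Fin m → X) × X => (f (Fin.cons w.2 w.1) - E) ^ (2 * k) :=
        ((hfc.comp measurable_swap).sub_const _).pow_const _
      refine integral_mono (integrable_of_measurable_of_abs_le (B := (2 * B) ^ (2 * k))
        (measurable_integral_right (φ := fun z x => (f (Fin.cons x z) - E) ^ (2 * k)) hm4)
        fun z => abs_integral_le_of_abs_le fun x => bd (hB _) hEB _)
        ((i1.const_mul _).add (i2.const_mul _)) fun z => ?_
      have j0 : Integrable (fun x => f (Fin.cons x z)) ν :=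
        integrable_of_measurable_of_abs_le (hfz z) fun x => hB _
      have j1 : Integrable (fun x => f (Fin.cons x z) - G z) ν := j0.sub (integrable_const _)
      have j2 : Integrable (fun x => (f (Fin.cons x z) - G z) ^ (2 * k)) ν :=
        integrable_of_measurable_of_abs_le (B := (2 * B) ^ (2 * k))
          (((hfz z).sub_const _).pow_const _) fun x => bd (hB _) (hGB _) _
      have j3 : Integrable (fun x => (f (Fin.cons x z) - E) ^ (2 * k)) ν :=
        integrable_of_measurable_of_abs_le (B := (2 * B) ^ (2 * k))
          (((hfz z).sub_const _).pow_const _) fun x => bd (hB _) hEB _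
      -- `hpt` is applied at `G z - E` and the increment `f - G z`, which has mean zero in x, so the
      -- linear term integrates to zero.
      have key : ∫ x, (f (Fin.cons x z) - E) ^ (2 * k) ∂ν
          ≤ ∫ x, ((1 + c) * (G z - E) ^ (2 * k)
            + 2 * k * (G z - E) ^ (2 * k - 1) * (f (Fin.cons x z) - G z)
            + A * (f (Fin.cons x z) - G z) ^ (2 * k)) ∂ν := by
        refine integral_mono j3 (((integrable_const _).add (j1.const_mul _)).add
          (j2.const_mul _)) fun x => ?_
        have := hpt (G z - E) (f (Fin.cons x z) - G z)
        rwa [show G z - E + (f (Fin.cons x z) - G z) = f (Fin.cons x z) - E by ring] at this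
      rw [integral_add (f := fun x => (1 + c) * (G z - E) ^ (2 * k)
          + 2 * k * (G z - E) ^ (2 * k - 1) * (f (Fin.cons x z) - G z))
          ((integrable_const _).add (j1.const_mul _)) (j2.const_mul _),
        integral_add (integrable_const _) (j1.const_mul _),
        integral_const_mul A, integral_const_mul _ (fun x => f (Fin.cons x z) - G z),
        integral_sub j0 (integrable_const _)] at key
      simpa [hG, integral_const_mul] using key
    calc _ ≤ _ := h3
      _ ≤ (1 + c) * ((1 + c) ^ m * m * A * W) + A * W := by gcongr
      _ ≤ (1 + c) * ((1 + c) ^ m * m * A * W) + (1 + c) ^ (m + 1) * (A * W) := by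
          refine add_le_add_right ?_ _
          exact le_mul_of_one_le_left (mul_nonneg hA hW0)
            (one_le_pow₀ (le_add_of_nonneg_right hc))
      _ = _ := by push_cast; ring

/-! ### Taylor bound for even powers. -/

/-- For |r| ≤ τ, compare with exp(2qr) and use eˣ ≤ 1 + x + x² on |x| ≤ 1; the quadratic term is at
most c. For |r| > τ, 1 + |r| ≤ (1 + 1/τ)|r|, so the top power dominates; its factor 2 also pays for
a negative linear term, by Bernoulli's inequality. -/
theorem one_add_pow_le_taylor {q : ℕ} {c τ : ℝ} (hτ : 0 < τ) (hqτ : 2 * q * τ ≤ 1)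
    (hc : (2 * q * τ) ^ 2 ≤ c) (r : ℝ) :
    (1 + r) ^ (2 * q) ≤ 1 + c + 2 * q * r + 2 * (1 + 1 / τ) ^ (2 * q) * r ^ (2 * q) := by
  have hc0 : 0 ≤ c := (sq_nonneg _).trans hc
  have he : Even (2 * q) := even_two_mul q
  rcases le_or_gt |r| τ with h | h
  · have h1 : |2 * q * r| ≤ 2 * q * τ := by
      rw [abs_mul, abs_of_nonneg (by positivity : (0:ℝ) ≤ 2 * q)]; gcongr
    have h2 := (abs_le.1 (Real.abs_exp_sub_one_sub_id_le (h1.trans hqτ))).2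
    have h3 : (1 + r) ^ (2 * q) ≤ Real.exp (2 * q * r) := by
      have h4 : |1 + r| ≤ Real.exp r ∨ q = 0 := by
        rcases Nat.eq_zero_or_pos q with hq | hq
        · exact Or.inr hq
        · left
          have hq1 : (1 : ℝ) ≤ q := by exact_mod_cast hq
          have : τ ≤ 1 := by nlinarith
          rw [abs_of_nonneg (by linarith [neg_abs_le r])]
          linarith [Real.add_one_le_exp r]
      rcases h4 with h4 | rfl
      · rw [← he.pow_abs]
        calc |1 + r| ^ (2 * q) ≤ Real.exp r ^ (2 * q) := pow_le_pow_left₀ (abs_nonneg _) h4 _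
          _ = _ := by rw [← Real.exp_nat_mul]; push_cast; ring_nf
      · simp
    have h5 : (2 * q * r) ^ 2 ≤ (2 * q * τ) ^ 2 := sq_le_sq' (by linarith [abs_le.1 h1])
      (by linarith [abs_le.1 h1])
    have h6 : 0 ≤ 2 * (1 + 1 / τ) ^ (2 * q) * r ^ (2 * q) := by
      have := he.pow_nonneg r
      positivity
    linarith
  · have h1 : (1 + |r|) ^ (2 * q) ≤ (1 + 1 / τ) ^ (2 * q) * r ^ (2 * q) := by
      rw [← he.pow_abs r, ← mul_pow]
      gcongr
      have : 1 ≤ 1 / τ * |r| := by rw [one_div, inv_mul_eq_div, one_le_div hτ]; exact h.le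
      linarith
    have h2 : (1 + r) ^ (2 * q) ≤ (1 + |r|) ^ (2 * q) := by
      rw [← he.pow_abs (1 + r)]
      gcongr
      exact (abs_add_le _ _).trans (by simp)
    have h3 : 1 + (2 * q : ℕ) * |r| ≤ (1 + |r|) ^ (2 * q) :=
      one_add_mul_le_pow (by linarith [abs_nonneg r]) _
    push_cast at h3
    have h4 : -(2 * q * r) ≤ 2 * q * |r| := by
      nlinarith [neg_abs_le r, (by positivity : (0:ℝ) ≤ 2 * q)]
    linarith

/-- Homogeneous form of the preceding bound, with r = y/x. -/
theorem add_pow_even_le_taylor {q : ℕ} (hq : 0 < q) {c τ : ℝ} (hτ : 0 < τ)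
    (hqτ : 2 * q * τ ≤ 1) (hc : (2 * q * τ) ^ 2 ≤ c) (x y : ℝ) :
    (x + y) ^ (2 * q) ≤ (1 + c) * x ^ (2 * q) + 2 * q * x ^ (2 * q - 1) * y
      + 2 * (1 + 1 / τ) ^ (2 * q) * y ^ (2 * q) := by
  have he : Even (2 * q) := even_two_mul q
  rcases eq_or_ne x 0 with rfl | hx
  · have h1 : 1 ≤ (1 + 1 / τ) ^ (2 * q) := one_le_pow₀ (by
      have : 0 < 1 / τ := by positivity
      linarith)
    have h2 := he.pow_nonneg y
    rcases Nat.lt_or_ge q 1 with h | h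
    · omega
    · rw [zero_pow (by omega), zero_pow (by omega)]
      simp only [zero_add, mul_zero, zero_mul]
      nlinarith
  · have h := mul_le_mul_of_nonneg_left (one_add_pow_le_taylor hτ hqτ hc (y / x))
      (he.pow_nonneg x)
    have e1 : x ^ (2 * q) * (1 + y / x) ^ (2 * q) = (x + y) ^ (2 * q) := by
      rw [← mul_pow]; congr 1; field_simp
    have e2 : x ^ (2 * q) * (y / x) ^ (2 * q) = y ^ (2 * q) := by
      rw [← mul_pow]; congr 1; field_simp
    have e3 : x ^ (2 * q) * (y / x) = x ^ (2 * q - 1) * y := by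
      rw [show 2 * q = 2 * q - 1 + 1 by omega, pow_succ]; simp; field_simp
    rw [e1] at h
    calc _ ≤ _ := h
      _ = (1 + c) * x ^ (2 * q) + 2 * q * (x ^ (2 * q) * (y / x))
        + 2 * (1 + 1 / τ) ^ (2 * q) * (x ^ (2 * q) * (y / x) ^ (2 * q)) := by ring
      _ = _ := by rw [e2, e3]; ring

/-! ### Moments from truncated exponential tails. -/

/-- Moments of a bounded variable with an exponential tail up to the level `s₀`. -/
theorem integral_pow_le_of_tail {Ω : Type*} [MeasurableSpace Ω] {P : Measure Ω}
    [IsProbabilityMeasure P] {D : Ω → ℝ} (hD : AEMeasurable D P) (h0 : ∀ ω, 0 ≤ D ω) {b s₀ : ℝ}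
    (hb : ∀ ω, D ω ≤ b)
    (htail : ∀ s, 0 ≤ s → s ≤ s₀ → P {ω | s ≤ D ω} ≤ ENNReal.ofReal (2 * Real.exp (-s)))
    {k : ℕ} (hk : 0 < k) (hs₀ : 0 ≤ s₀) (hbs : b ^ k * (2 * Real.exp (-s₀)) ≤ 1) :
    ∫ ω, D ω ^ k ∂P ≤ 2 * k.factorial + 1 := by
  have hk' : (0 : ℝ) < k := by exact_mod_cast hk
  obtain ⟨ω₀⟩ : Nonempty Ω := P.nonempty_of_neZero
  have hb0 : 0 ≤ b := (h0 ω₀).trans (hb ω₀)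
  have hlc := lintegral_rpow_eq_lintegral_meas_le_mul P (f := D) (Filter.Eventually.of_forall h0)
    hD hk'
  -- Layer-cake integrand: up to `s₀` the exponential tail applies, from `s₀` to `b` the tail is
  -- frozen at its value at `s₀`, and above `b` it is zero. The two majorants produce a Gamma
  -- integral and a remainder at most 1.
  have hpt : ∀ t ∈ Set.Ioi (0 : ℝ), P {a | t ≤ D a} * ENNReal.ofReal (t ^ ((k : ℝ) - 1))
      ≤ ENNReal.ofReal (2 * (Real.exp (-t) * t ^ ((k : ℝ) - 1)))
        + (Set.Ioc 0 b).indicator (fun t => ENNReal.ofReal (2 * Real.exp (-s₀) *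
            t ^ ((k : ℝ) - 1))) t := by
    intro t ht
    have ht0 : (0 : ℝ) < t := ht
    have hr : (0 : ℝ) ≤ t ^ ((k : ℝ) - 1) := Real.rpow_nonneg ht0.le _
    rcases le_or_gt t s₀ with h | h
    · refine le_trans ?_ le_self_add
      calc _ ≤ ENNReal.ofReal (2 * Real.exp (-t)) * ENNReal.ofReal (t ^ ((k : ℝ) - 1)) := by
            gcongr; exact htail t ht0.le h
        _ = _ := by rw [← ENNReal.ofReal_mul (by positivity)]; ring_nf
    · rcases le_or_gt t b with h' | h'
      · refine le_trans ?_ le_add_self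
        rw [Set.indicator_of_mem (show t ∈ Set.Ioc 0 b from ⟨ht0, h'⟩)]
        calc _ ≤ ENNReal.ofReal (2 * Real.exp (-s₀)) * ENNReal.ofReal (t ^ ((k : ℝ) - 1)) := by
              gcongr
              exact (measure_mono fun ω (hω : t ≤ D ω) => h.le.trans hω).trans
                (htail s₀ hs₀ le_rfl)
          _ = _ := by rw [← ENNReal.ofReal_mul (by positivity)]
      · have : {a | t ≤ D a} = ∅ := by
          ext a; simpa using (hb a).trans_lt h'
        simp [this]
  have hG := Real.GammaIntegral_convergent hk'
  have i1 : ∫⁻ t in Set.Ioi (0 : ℝ), ENNReal.ofReal (2 * (Real.exp (-t) * t ^ ((k : ℝ) - 1)))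
      = ENNReal.ofReal (2 * Real.Gamma k) := by
    rw [Real.Gamma_eq_integral hk', ← integral_const_mul, ofReal_integral_eq_lintegral_ofReal
      (hG.const_mul 2)]
    filter_upwards [ae_restrict_mem measurableSet_Ioi] with t ht
    have ht0 : (0 : ℝ) < t := ht
    show 0 ≤ 2 * (Real.exp (-t) * t ^ ((k : ℝ) - 1))
    positivity
  have i2 : ∫⁻ t in Set.Ioi (0 : ℝ), (Set.Ioc 0 b).indicator
      (fun t => ENNReal.ofReal (2 * Real.exp (-s₀) * t ^ ((k : ℝ) - 1))) t
      ≤ ENNReal.ofReal (2 * Real.exp (-s₀) * (b ^ k / k)) := by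
    have hii : IntervalIntegrable (fun t : ℝ => t ^ ((k : ℝ) - 1)) volume 0 b :=
      intervalIntegral.intervalIntegrable_rpow' (by linarith)
    have : b ^ k / k = ∫ t in Set.Ioc 0 b, t ^ ((k : ℝ) - 1) := by
      rw [← intervalIntegral.integral_of_le hb0, integral_rpow (Or.inl (by linarith))]
      simp [hk.ne']
    rw [this, ← integral_const_mul, ofReal_integral_eq_lintegral_ofReal]
    · refine (setLIntegral_le_lintegral _ _).trans ?_
      rw [lintegral_indicator measurableSet_Ioc]
    · exact ((intervalIntegrable_iff_integrableOn_Ioc_of_le hb0).1 hii).const_mul _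
    · filter_upwards [ae_restrict_mem measurableSet_Ioc] with t ht
      have ht0 : (0 : ℝ) < t := ht.1
      show 0 ≤ 2 * Real.exp (-s₀) * t ^ ((k : ℝ) - 1)
      positivity
  have hmeas : Measurable fun t : ℝ => ENNReal.ofReal (2 * (Real.exp (-t) * t ^ ((k : ℝ) - 1))) := by
    fun_prop
  have hfin : ∫⁻ ω, ENNReal.ofReal (D ω ^ k) ∂P ≤ ENNReal.ofReal (2 * k.factorial + 1) := by
    simp only [Real.rpow_natCast] at hlc
    rw [hlc]
    calc _ ≤ ENNReal.ofReal k * ∫⁻ t in Set.Ioi (0 : ℝ),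
          (ENNReal.ofReal (2 * (Real.exp (-t) * t ^ ((k : ℝ) - 1)))
            + (Set.Ioc 0 b).indicator (fun t => ENNReal.ofReal (2 * Real.exp (-s₀) *
              t ^ ((k : ℝ) - 1))) t) := by
            gcongr 1
            exact setLIntegral_mono' measurableSet_Ioi hpt
      _ ≤ ENNReal.ofReal k * (ENNReal.ofReal (2 * Real.Gamma k)
          + ENNReal.ofReal (2 * Real.exp (-s₀) * (b ^ k / k))) := by
            rw [lintegral_add_left hmeas, i1]
            gcongr
      _ = ENNReal.ofReal (2 * k.factorial + b ^ k * (2 * Real.exp (-s₀))) := by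
            have hΓ : (k : ℝ) * Real.Gamma k = k.factorial := by
              rw [← Real.Gamma_add_one hk'.ne', Real.Gamma_nat_eq_factorial]
            have := Real.Gamma_pos_of_pos hk'
            rw [← ENNReal.ofReal_add (by positivity) (by positivity),
              ← ENNReal.ofReal_mul hk'.le, ← hΓ]
            congr 1
            field_simp
      _ ≤ _ := ENNReal.ofReal_le_ofReal (by linarith)
  rw [integral_eq_lintegral_of_nonneg_ae (Filter.Eventually.of_forall fun ω =>
    pow_nonneg (h0 ω) k) (hD.pow_const k).aestronglyMeasurable]
  exact ENNReal.toReal_le_of_le_ofReal (by positivity) hfin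

/-! ### Selecting and resampling coordinates of a product measure. -/

/-- The image of a product measure under an injective selection of coordinates. -/
theorem measurePreserving_comp_injective {X ι κ : Type*} [MeasurableSpace X] [Fintype ι]
    [Fintype κ] (ν : Measure X) [IsProbabilityMeasure ν] {e : κ → ι}
    (he : Function.Injective e) :
    MeasurePreserving (fun (Z : ι → X) k => Z (e k)) (Measure.pi fun _ : ι => ν)
      (Measure.pi fun _ : κ => ν) := by
  classical
  refine ⟨by fun_prop, (Measure.pi_eq fun s hs => ?_).symm⟩
  rw [Measure.map_apply (by fun_prop) (MeasurableSet.univ_pi hs)]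
  have : (fun (Z : ι → X) k => Z (e k)) ⁻¹' Set.univ.pi s
      = Set.univ.pi fun i => if h : ∃ k, e k = i then s h.choose else Set.univ := by
    ext Z
    simp only [Set.mem_preimage, Set.mem_pi, Set.mem_univ, true_imp_iff]
    constructor
    · intro h i
      split_ifs with hi
      · have := h hi.choose
        rwa [hi.choose_spec] at this
      · trivial
    · intro h k
      have hk : ∃ k', e k' = e k := ⟨k, rfl⟩
      have := h (e k)
      rw [dif_pos hk, he hk.choose_spec] at this
      exact this
  rw [this, Measure.pi_pi]
  have h2 : ∀ i, ν (if h : ∃ k, e k = i then s h.choose else Set.univ)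
      = if h : ∃ k, e k = i then ν (s h.choose) else 1 := fun i => by
    split_ifs <;> simp
  simp only [h2]
  rw [← Finset.prod_subset (Finset.subset_univ (Finset.univ.image e)),
    Finset.prod_image (fun a _ b _ h => he h)]
  · refine Finset.prod_congr rfl fun k _ => ?_
    have hk : ∃ k', e k' = e k := ⟨k, rfl⟩
    rw [dif_pos hk, he hk.choose_spec]
  · intro i _ hi
    rw [dif_neg]
    simpa using hi

/-- Resampling a coordinate preserves the law; hence almost everywhere identities and moments
transfer to the resampled point. -/
theorem measurePreserving_update {X ι : Type*} [MeasurableSpace X] [Fintype ι] [DecidableEq ι]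
    (ν : Measure X) [IsProbabilityMeasure ν] (i : ι) :
    MeasurePreserving (fun w : (ι → X) × X => Function.update w.1 i w.2)
      ((Measure.pi fun _ : ι => ν).prod ν) (Measure.pi fun _ : ι => ν) := by
  refine ⟨measurable_update', (Measure.pi_eq fun s hs => ?_).symm⟩
  rw [Measure.map_apply measurable_update' (MeasurableSet.univ_pi hs)]
  have : (fun w : (ι → X) × X => Function.update w.1 i w.2) ⁻¹' Set.univ.pi s
      = (Set.univ.pi (Function.update s i Set.univ)) ×ˢ s i := by
    ext ⟨z, x⟩
    simp only [Set.mem_preimage, Set.mem_pi, Set.mem_univ, true_imp_iff, Set.mem_prod]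
    constructor
    · intro h
      refine ⟨fun j => ?_, by simpa using h i⟩
      rcases eq_or_ne j i with rfl | hj
      · simp
      · simpa [hj] using h j
    · rintro ⟨h, hi⟩ j
      rcases eq_or_ne j i with rfl | hj
      · simpa using hi
      · simpa [hj] using h j
  rw [this, Measure.prod_prod, Measure.pi_pi, ← Finset.mul_prod_erase _ _ (Finset.mem_univ i),
    ← Finset.mul_prod_erase _ (fun j => ν (s j)) (Finset.mem_univ i), mul_comm]
  congr 1
  simp only [Function.update_self, measure_univ, one_mul]
  refine Finset.prod_congr rfl fun j hj => ?_
  rw [Function.update_of_ne (Finset.ne_of_mem_erase hj)]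

/-! ### Concentration from moments of increments. -/

/-- Moments of a function of independent variables whose increments under resampling are
controlled by variables with bounded moments. -/
theorem integral_pow_sub_mean_le_of_increments {X : Type*} [MeasurableSpace X] (ν : Measure X)
    [IsProbabilityMeasure ν] {k : ℕ} (hk : 0 < k) {c A V B B' : ℝ} (hc : 0 ≤ c) (hA : 0 ≤ A)
    (hpt : ∀ x y : ℝ, (x + y) ^ (2 * k)
      ≤ (1 + c) * x ^ (2 * k) + 2 * k * x ^ (2 * k - 1) * y + A * y ^ (2 * k))
    {m : ℕ} {f : (Fin m → X) → ℝ} (hf : AEMeasurable f (Measure.pi fun _ => ν))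
    (hB : ∀ z, |f z| ≤ B) (D : Fin m → (Fin m → X) → ℝ)
    (hD : ∀ i, AEMeasurable (D i) (Measure.pi fun _ => ν)) (hD0 : ∀ i z, 0 ≤ D i z)
    (hDB : ∀ i z, D i z ≤ B')
    (hfD : ∀ i z x, |f z - f (Function.update z i x)| ≤ D i z + D i (Function.update z i x))
    (hV : ∀ i, ∫ z, D i z ^ (2 * k) ∂(Measure.pi fun _ : Fin m => ν) ≤ V) :
    ∫ z, (f z - ∫ z', f z' ∂(Measure.pi fun _ : Fin m => ν)) ^ (2 * k)
        ∂(Measure.pi fun _ : Fin m => ν) ≤ (1 + c) ^ m * m * A * (4 ^ k * V) := by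
  set P := Measure.pi fun _ : Fin m => ν with hP
  have hB0 : 0 ≤ B := by
    obtain ⟨z⟩ : Nonempty (Fin m → X) := P.nonempty_of_neZero
    exact (abs_nonneg _).trans (hB z)
  -- The induction needs a measurable function bounded everywhere, so a measurable version of `f` is
  -- clipped to [-B, B].
  obtain ⟨f₀, hf₀, hf₀B, hff₀⟩ : ∃ f₀ : (Fin m → X) → ℝ, Measurable f₀ ∧ (∀ z, |f₀ z| ≤ B) ∧
      f =ᵐ[P] f₀ := by
    refine ⟨fun z => max (-B) (min (hf.mk f z) B), measurable_const.max
      (hf.measurable_mk.min measurable_const), fun z => abs_le.2 ⟨le_max_left _ _,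
      max_le (by linarith) (min_le_right _ _)⟩, ?_⟩
    filter_upwards [hf.ae_eq_mk] with z hz
    rw [← hz, min_eq_left (abs_le.1 (hB z)).2, max_eq_right (abs_le.1 (hB z)).1]
  have hE : ∫ z', f z' ∂P = ∫ z', f₀ z' ∂P := integral_congr_ae hff₀
  have hI : ∫ z, (f z - ∫ z', f z' ∂P) ^ (2 * k) ∂P
      = ∫ z, (f₀ z - ∫ z', f₀ z' ∂P) ^ (2 * k) ∂P := by
    refine integral_congr_ae ?_
    filter_upwards [hff₀] with z hz
    rw [hE, hz]
  rw [hI]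
  refine integral_pow_sub_mean_le ν hk hc hA hpt m f₀ hf₀ hf₀B fun i => ?_
  have hu := measurePreserving_update ν i
  have hfst : MeasurePreserving Prod.fst (P.prod ν) P := measurePreserving_fst
  have hm : Measurable fun w : (Fin m → X) × X =>
      (f₀ w.1 - f₀ (Function.update w.1 i w.2)) ^ (2 * k) :=
    ((hf₀.comp measurable_fst).sub (hf₀.comp hu.measurable)).pow_const _
  have hbd : ∀ w : (Fin m → X) × X,
      |(f₀ w.1 - f₀ (Function.update w.1 i w.2)) ^ (2 * k)| ≤ (2 * B) ^ (2 * k) := fun w => by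
    rw [abs_pow]
    exact pow_le_pow_left₀ (abs_nonneg _)
      ((abs_sub _ _).trans (by linarith [hf₀B w.1, hf₀B (Function.update w.1 i w.2)])) _
  have hint := integrable_of_measurable_of_abs_le (μ := P.prod ν) hm hbd
  have hDi : Integrable (fun z => D i z ^ (2 * k)) P := by
    refine Integrable.of_bound ((hD i).pow_const _).aestronglyMeasurable (B' ^ (2 * k))
      (Filter.Eventually.of_forall fun z => ?_)
    rw [Real.norm_eq_abs, abs_of_nonneg (pow_nonneg (hD0 i z) _)]
    exact pow_le_pow_left₀ (hD0 i z) (hDB i z) _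
  have hD1 : Integrable (fun w : (Fin m → X) × X => D i w.1 ^ (2 * k)) (P.prod ν) :=
    hfst.integrable_comp_of_integrable hDi
  have hD2 : Integrable (fun w : (Fin m → X) × X =>
      D i (Function.update w.1 i w.2) ^ (2 * k)) (P.prod ν) :=
    hu.integrable_comp_of_integrable hDi
  have hI1 : ∫ w : (Fin m → X) × X, D i w.1 ^ (2 * k) ∂(P.prod ν) = ∫ z, D i z ^ (2 * k) ∂P := by
    rw [← integral_map (f := fun z => D i z ^ (2 * k)) hfst.measurable.aemeasurable
      (by rw [hfst.map_eq]; exact hDi.aestronglyMeasurable), hfst.map_eq]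
  have hI2 : ∫ w : (Fin m → X) × X, D i (Function.update w.1 i w.2) ^ (2 * k) ∂(P.prod ν)
      = ∫ z, D i z ^ (2 * k) ∂P := by
    rw [← integral_map (f := fun z => D i z ^ (2 * k)) hu.measurable.aemeasurable
      (by rw [hu.map_eq]; exact hDi.aestronglyMeasurable), hu.map_eq]
  calc _ = ∫ w : (Fin m → X) × X, (f₀ w.1 - f₀ (Function.update w.1 i w.2)) ^ (2 * k)
        ∂(P.prod ν) := (integral_prod _ hint).symm
    _ ≤ ∫ w : (Fin m → X) × X, 2 ^ (2 * k - 1) * (D i w.1 ^ (2 * k)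
        + D i (Function.update w.1 i w.2) ^ (2 * k)) ∂(P.prod ν) := by
        refine integral_mono_ae hint ((hD1.add hD2).const_mul _) ?_
        filter_upwards [hfst.quasiMeasurePreserving.ae_eq_comp hff₀,
          hu.quasiMeasurePreserving.ae_eq_comp hff₀] with w h1 h2
        simp only [Function.comp] at h1 h2
        rw [← h1, ← h2, ← (even_two_mul k).pow_abs]
        exact (pow_le_pow_left₀ (abs_nonneg _) (hfD i w.1 w.2) _).trans
          (add_pow_le (hD0 _ _) (hD0 _ _) _)
    _ = 4 ^ k * ∫ z, D i z ^ (2 * k) ∂P := by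
        rw [integral_const_mul, integral_add hD1 hD2, hI1, hI2, show (4:ℝ) = 2 ^ 2 by norm_num,
          ← pow_mul, show 2 * k = 2 * k - 1 + 1 by omega, pow_succ]
        simp
        ring
    _ ≤ _ := by gcongr; exact hV i

theorem measure_abs_ge_le_of_integral_pow_le {Ω : Type*} [MeasurableSpace Ω] {P : Measure Ω}
    {Y : Ω → ℝ} {k : ℕ} (hY : Integrable (fun ω => Y ω ^ (2 * k)) P) {t U : ℝ} (ht : 0 < t)
    (hU : ∫ ω, Y ω ^ (2 * k) ∂P ≤ U) :
    P {ω | t ≤ |Y ω|} ≤ ENNReal.ofReal (U / t ^ (2 * k)) := by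
  have h1 := mul_meas_ge_le_lintegral₀ (μ := P) (f := fun ω => ENNReal.ofReal (Y ω ^ (2 * k)))
    hY.aemeasurable.ennreal_ofReal (ENNReal.ofReal (t ^ (2 * k)))
  rw [← ofReal_integral_eq_lintegral_ofReal hY (Filter.Eventually.of_forall fun ω =>
    (even_two_mul k).pow_nonneg _)] at h1
  have htk : 0 < t ^ (2 * k) := by positivity
  rw [ENNReal.ofReal_div_of_pos htk, ENNReal.le_div_iff_mul_le
    (Or.inl (ENNReal.ofReal_pos.2 htk).ne') (Or.inl ENNReal.ofReal_ne_top), mul_comm]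
  refine le_trans ?_ (h1.trans (ENNReal.ofReal_le_ofReal hU))
  gcongr with ω
  intro hω
  rw [← (even_two_mul k).pow_abs (Y ω)]
  exact ENNReal.ofReal_le_ofReal (pow_le_pow_left₀ ht.le hω _)

/-- Concentration of a function of `m` independent variables whose increments have the moments
of an exponential variable with scale `L`. -/
theorem measure_abs_sub_mean_ge_le {X : Type*} [MeasurableSpace X] (ν : Measure X)
    [IsProbabilityMeasure ν] {q m : ℕ} (hq : 0 < q) (hqm : q ≤ m) {L B B' t : ℝ}
    {f : (Fin m → X) → ℝ} (hf : AEMeasurable f (Measure.pi fun _ => ν))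
    (hB : ∀ z, |f z| ≤ B) (D : Fin m → (Fin m → X) → ℝ)
    (hD : ∀ i, AEMeasurable (D i) (Measure.pi fun _ => ν)) (hD0 : ∀ i z, 0 ≤ D i z)
    (hDB : ∀ i z, D i z ≤ B')
    (hfD : ∀ i z x, |f z - f (Function.update z i x)| ≤ D i z + D i (Function.update z i x))
    (hV : ∀ i, ∫ z, D i z ^ (2 * q) ∂(Measure.pi fun _ : Fin m => ν)
      ≤ L ^ (2 * q) * (2 * (2 * q).factorial + 1))
    (ht : 0 < t) (htL : 144 * Real.exp 9 * q ^ 3 * m * L ^ 2 ≤ t ^ 2) :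
    (Measure.pi fun _ : Fin m => ν)
      {z | t ≤ |f z - ∫ z', f z' ∂(Measure.pi fun _ : Fin m => ν)|}
      ≤ ENNReal.ofReal (6 * m * Real.exp (-(8 * q))) := by
  have hq0 : (1 : ℝ) ≤ q := by exact_mod_cast hq
  have hqmR : (q : ℝ) ≤ m := by exact_mod_cast hqm
  have hm0 : (0 : ℝ) < m := by linarith
  set P := Measure.pi fun _ : Fin m => ν with hP
  have hr : 0 < √((q : ℝ) * m) := Real.sqrt_pos.2 (by positivity)
  have hr2 : √((q : ℝ) * m) ^ 2 = q * m := Real.sq_sqrt (by positivity)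
  have hqr : (q : ℝ) ≤ √((q : ℝ) * m) := Real.le_sqrt_of_sq_le (by nlinarith)
  -- This τ makes (2qτ)² = q/m = c, so (1 + c)^m ≤ e^q, while the Taylor constant is only of order
  -- (9qm)^q.
  have hτ : 0 < 1 / (2 * √((q : ℝ) * m)) := by positivity
  have h2 : 2 * q * (1 / (2 * √((q : ℝ) * m))) = q / √((q : ℝ) * m) := by field_simp
  have h1 := integral_pow_sub_mean_le_of_increments ν hq (c := q / m)
    (A := 2 * (1 + 1 / (1 / (2 * √((q : ℝ) * m)))) ^ (2 * q)) (by positivity) (by positivity)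
    (add_pow_even_le_taylor hq hτ (by rw [h2, div_le_one hr]; exact hqr)
      (by rw [h2, div_pow, hr2]; apply le_of_eq; field_simp)) hf hB D hD hD0 hDB hfD hV
  have hEB : |∫ z', f z' ∂P| ≤ B := abs_integral_le_of_abs_le hB
  have hY : Integrable (fun z => (f z - ∫ z', f z' ∂P) ^ (2 * q)) P := by
    refine Integrable.of_bound ((hf.sub_const _).pow_const _).aestronglyMeasurable
      ((2 * B) ^ (2 * q)) (Filter.Eventually.of_forall fun z => ?_)
    rw [Real.norm_eq_abs, abs_pow]
    exact pow_le_pow_left₀ (abs_nonneg _) ((abs_sub _ _).trans (by linarith [hB z])) _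
  refine (measure_abs_ge_le_of_integral_pow_le hY ht h1).trans (ENNReal.ofReal_le_ofReal ?_)
  rw [div_le_iff₀ (by positivity)]
  have e1 : (1 + (q : ℝ) / m) ^ m ≤ Real.exp 1 ^ q := by
    calc (1 + (q : ℝ) / m) ^ m ≤ Real.exp (q / m) ^ m := by
          gcongr
          linarith [Real.add_one_le_exp ((q : ℝ) / m)]
      _ = _ := by
          rw [← Real.exp_nat_mul, ← Real.exp_nat_mul]; congr 1; field_simp
  have e2 : (1 + 1 / (1 / (2 * √((q : ℝ) * m)))) ^ (2 * q) ≤ (9 * (q * m)) ^ q := by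
    rw [one_div_one_div, pow_mul]
    refine pow_le_pow_left₀ (by positivity) ?_ q
    nlinarith
  have e3 : (2 * ((2 * q).factorial : ℝ) + 1) ≤ 3 * (4 * q ^ 2) ^ q := by
    have : ((2 * q).factorial : ℝ) ≤ (2 * q : ℕ) ^ (2 * q) := by
      exact_mod_cast Nat.factorial_le_pow _
    have h3 : (1 : ℝ) ≤ (2 * q).factorial := by exact_mod_cast Nat.factorial_pos _
    rw [pow_mul] at this
    push_cast at this
    rw [show (2 * (q : ℝ)) ^ 2 = 4 * q ^ 2 by ring] at this
    linarith
  have e4 : (144 * Real.exp 9 * q ^ 3 * m * L ^ 2) ^ q ≤ t ^ (2 * q) := by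
    rw [pow_mul]; gcongr
  have hL : L ^ (2 * q) = (L ^ 2) ^ q := pow_mul _ _ _
  -- The e^9 in the threshold supplies e^(-9q); the growth factor e^q uses up one ninth of the
  -- exponent. The 144 is 9·4·4, from the Taylor constant, the resampling factor and (2q)! ≤
  -- (4q²)^q.
  have e5 : Real.exp (-(8 * q)) * (Real.exp 9) ^ q = Real.exp 1 ^ q := by
    rw [← Real.exp_nat_mul, ← Real.exp_nat_mul, ← Real.exp_add]; ring_nf
  calc _ ≤ Real.exp 1 ^ q * m * (2 * (9 * (q * m)) ^ q)
        * (4 ^ q * ((L ^ 2) ^ q * (3 * (4 * q ^ 2) ^ q))) := by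
        rw [hL]; gcongr
    _ = 6 * m * (Real.exp 1 ^ q) * (144 * q ^ 3 * m * L ^ 2) ^ q := by
        rw [show (144 * (q : ℝ) ^ 3 * m * L ^ 2) = (9 * (q * m)) * 4 * L ^ 2 * (4 * q ^ 2) by ring,
          mul_pow _ (4 * (q : ℝ) ^ 2), mul_pow _ (L ^ 2), mul_pow _ (4 : ℝ)]
        ring
    _ = 6 * m * Real.exp (-(8 * q)) * (144 * Real.exp 9 * q ^ 3 * m * L ^ 2) ^ q := by
        rw [← e5, show 144 * Real.exp 9 * (q : ℝ) ^ 3 * m * L ^ 2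
          = Real.exp 9 * (144 * q ^ 3 * m * L ^ 2) by ring, mul_pow (Real.exp 9)]
        ring
    _ ≤ _ := by gcongr

/-! ### Bernoulli subsampling. -/

namespace LearningTask

theorem isProbabilityMeasure_bern {p : ℝ} (hp0 : 0 ≤ p) (hp1 : p ≤ 1) :
    IsProbabilityMeasure (bern p) := by
  constructor
  simp [bern, ← ENNReal.ofReal_add hp0 (sub_nonneg.2 hp1)]

theorem integral_bern {p : ℝ} (hp0 : 0 ≤ p) (hp1 : p ≤ 1) (g : Bool → ℝ) :
    ∫ b, g b ∂(bern p) = p * g true + (1 - p) * g false := by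
  rw [bern, integral_add_measure, integral_smul_measure, integral_smul_measure, integral_dirac,
    integral_dirac, ENNReal.toReal_ofReal hp0, ENNReal.toReal_ofReal (sub_nonneg.2 hp1),
    smul_eq_mul, smul_eq_mul]
  · exact (integrable_dirac (by simp)).smul_measure ENNReal.ofReal_ne_top
  · exact (integrable_dirac (by simp)).smul_measure ENNReal.ofReal_ne_top

/-- By 1 + x ≤ eˣ the integral is at most exp(p(eˢ - 1 - s)), and eˢ - 1 - s ≤ s² for |s| ≤ 1.
Keeping p in the exponent makes the Chernoff deviations scale as √(pn). -/
theorem integral_exp_bern_le {p s : ℝ} (hp0 : 0 ≤ p) (hp1 : p ≤ 1) (hs : |s| ≤ 1) :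
    ∫ b, Real.exp (s * ((if b then 1 else 0) - p)) ∂(bern p) ≤ Real.exp (p * s ^ 2) := by
  rw [integral_bern hp0 hp1]
  have h1 := (abs_le.1 (Real.abs_exp_sub_one_sub_id_le hs)).2
  have h2 : p * Real.exp (s * (1 - p)) + (1 - p) * Real.exp (s * (0 - p))
      = Real.exp (-(s * p)) * (1 + p * (Real.exp s - 1)) := by
    rw [show s * (1 - p) = -(s * p) + s by ring, Real.exp_add, show s * (0 - p) = -(s * p) by ring]
    ring
  simp only [if_true, Bool.false_eq_true, if_false]
  rw [h2]
  calc _ ≤ Real.exp (-(s * p)) * Real.exp (p * (Real.exp s - 1)) := by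
        gcongr
        linarith [Real.add_one_le_exp (p * (Real.exp s - 1))]
    _ = Real.exp (-(s * p) + p * (Real.exp s - 1)) := (Real.exp_add _ _).symm
    _ ≤ _ := by
        gcongr
        nlinarith

/-- Two-sided Chernoff bound for the number of ones. -/
theorem measure_abs_card_sub_ge_le {p : ℝ} (hp0 : 0 < p) (hp1 : p ≤ 1) {n : ℕ} (hn : 0 < n)
    {τ : ℝ} (hτ0 : 0 ≤ τ) (hτ : τ ≤ 2 * (p * n)) :
    (Measure.pi fun _ : Fin n => bern p)
      {b | τ ≤ |(Fintype.card {i // b i = true} : ℝ) - p * n|}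
      ≤ ENNReal.ofReal (2 * Real.exp (-(τ ^ 2 / (4 * (p * n))))) := by
  have := isProbabilityMeasure_bern hp0.le hp1
  have hn' : (0 : ℝ) < n := by exact_mod_cast hn
  have hX : 0 < p * n := by positivity
  set P := Measure.pi fun _ : Fin n => bern p with hP
  let Y : (Fin n → Bool) → ℝ := fun b => ∑ i, ((if b i then 1 else 0) - p)
  have hY : ∀ b, (Fintype.card {i // b i = true} : ℝ) - p * n = Y b := fun b => by
    simp only [Y, Finset.sum_sub_distrib, Finset.sum_const, Finset.card_univ, Fintype.card_fin,
      nsmul_eq_mul, Fintype.card_subtype]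
    rw [Finset.sum_boole]
    ring
  have hmgf : ∀ s : ℝ, |s| ≤ 1 → mgf Y P s ≤ Real.exp (p * n * s ^ 2) := fun s hs => by
    have : ∀ b, Real.exp (s * Y b) = ∏ i, Real.exp (s * ((if b i then 1 else 0) - p)) :=
      fun b => by rw [← Real.exp_sum, ← Finset.mul_sum]
    simp only [mgf, this]
    rw [hP, integral_fintype_prod_eq_pow (ι := Fin n)
      (fun b : Bool => Real.exp (s * ((if b then 1 else 0) - p))), Fintype.card_fin]
    calc _ ≤ Real.exp (p * s ^ 2) ^ n := by
          refine pow_le_pow_left₀ (integral_nonneg ?_) (integral_exp_bern_le hp0.le hp1 hs) n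
          intro b
          positivity
      _ = _ := by rw [← Real.exp_nat_mul]; ring_nf
  have hint : ∀ s : ℝ, Integrable (fun b => Real.exp (s * Y b)) P := fun s =>
    Integrable.of_finite
  -- Minimizer of -sτ + pn s²; the assumption on τ says exactly that s ≤ 1.
  set s := τ / (2 * (p * n)) with hs
  have hs0 : 0 ≤ s := by positivity
  have hs1 : s ≤ 1 := (div_le_one (by positivity)).2 hτ
  have hexp : -s * τ + p * n * s ^ 2 = -(τ ^ 2 / (4 * (p * n))) := by
    rw [hs]; field_simp; ring
  have h1 : P.real {b | τ ≤ Y b} ≤ Real.exp (-(τ ^ 2 / (4 * (p * n)))) := by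
    refine (measure_ge_le_exp_mul_mgf τ hs0 (hint s)).trans ?_
    rw [← hexp, Real.exp_add]
    gcongr
    exact hmgf s (by rwa [abs_of_nonneg hs0])
  have h2 : P.real {b | Y b ≤ -τ} ≤ Real.exp (-(τ ^ 2 / (4 * (p * n)))) := by
    refine (measure_le_le_exp_mul_mgf (-τ) (neg_nonpos.2 hs0) (hint (-s))).trans ?_
    rw [← hexp, Real.exp_add, show - -s * -τ = -s * τ by ring]
    gcongr
    simpa using hmgf (-s) (by rwa [abs_neg, abs_of_nonneg hs0])
  have hsub : {b | τ ≤ |(Fintype.card {i // b i = true} : ℝ) - p * n|}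
      ⊆ {b | τ ≤ Y b} ∪ {b | Y b ≤ -τ} := fun b hb => by
    simp only [Set.mem_ofPred_eq, hY] at hb
    rcases le_abs.1 hb with h | h
    · exact Or.inl h
    · exact Or.inr (show Y b ≤ -τ by linarith)
  refine (measure_mono hsub).trans ((measure_union_le _ _).trans ?_)
  rw [two_mul, ENNReal.ofReal_add (Real.exp_pos _).le (Real.exp_pos _).le]
  refine add_le_add ?_ ?_
  · rw [← ofReal_measureReal]; exact ENNReal.ofReal_le_ofReal h1
  · rw [← ofReal_measureReal]; exact ENNReal.ofReal_le_ofReal h2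

/-- A set is small under the joint law if its sections over typical bit vectors are small and
atypical bit vectors are rare. -/
theorem subsampleLaw_le {𝒵 : Type*} [MeasurableSpace 𝒵] {d : ℕ} (T : LearningTask 𝒵 d) {p : ℝ}
    (hp0 : 0 ≤ p) (hp1 : p ≤ 1) {n : ℕ} (A : Set ((Fin n → 𝒵) × (Fin n → Bool)))
    (G : Set (Fin n → Bool)) {ε₁ ε₂ : ENNReal}
    (h1 : ∀ b ∈ G, T.sampleLaw n {Z | (Z, b) ∈ A} ≤ ε₁)
    (h2 : (Measure.pi fun _ : Fin n => bern p) Gᶜ ≤ ε₂) :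
    T.subsampleLaw p n A ≤ ε₁ + ε₂ := by
  classical
  have := isProbabilityMeasure_bern hp0 hp1
  have := T.isProbabilityMeasure_D
  have : IsProbabilityMeasure (T.sampleLaw n) := by unfold sampleLaw; infer_instance
  set Q := Measure.pi fun _ : Fin n => bern p with hQ
  -- There are finitely many bit vectors, so a union of sections replaces Fubini and `A` need not be
  -- measurable.
  have hsub : A ⊆ (⋃ b ∈ Finset.univ.filter (· ∈ G), {Z | (Z, b) ∈ A} ×ˢ {b})
      ∪ Set.univ ×ˢ Gᶜ := by
    rintro ⟨Z, b⟩ h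
    by_cases hb : b ∈ G
    · left
      simp only [Set.mem_iUnion]
      exact ⟨b, by simpa using hb, h, rfl⟩
    · exact Or.inr ⟨trivial, hb⟩
  calc T.subsampleLaw p n A ≤ _ := measure_mono hsub
    _ ≤ _ := measure_union_le _ _
    _ ≤ ε₁ + ε₂ := by
      refine add_le_add ?_ ?_
      · refine (measure_biUnion_finset_le _ _).trans ?_
        calc ∑ b ∈ Finset.univ.filter (· ∈ G), T.subsampleLaw p n ({Z | (Z, b) ∈ A} ×ˢ {b})
            ≤ ∑ b ∈ Finset.univ.filter (· ∈ G), ε₁ * Q {b} := by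
              refine Finset.sum_le_sum fun b hb => ?_
              rw [subsampleLaw, Measure.prod_prod]
              gcongr
              exact h1 b (Finset.mem_filter.1 hb).2
          _ = ε₁ * Q (Finset.univ.filter (· ∈ G) : Finset (Fin n → Bool)) := by
              rw [← Finset.mul_sum, sum_measure_singleton]
          _ ≤ ε₁ := by
              calc _ ≤ ε₁ * 1 := by gcongr; exact prob_le_one
                _ = ε₁ := mul_one _
      · rw [subsampleLaw, Measure.prod_prod, measure_univ, one_mul]
        exact h2

end LearningTask

/-! ### Bounds and rescaling of the losses. -/

namespace LearningTask

variable {𝒵 : Type*} [MeasurableSpace 𝒵] {d : ℕ} (T : LearningTask 𝒵 d)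

theorem isProbabilityMeasure_sampleLaw (n : ℕ) : IsProbabilityMeasure (T.sampleLaw n) := by
  have := T.isProbabilityMeasure_D
  unfold sampleLaw
  infer_instance

theorem empLoss_nonneg {θ : Fin (d + 1) → ℝ} (hθ : θ ∈ T.Θ) {n : ℕ} (S : Fin n → Option 𝒵) :
    0 ≤ T.empLoss θ S := by
  refine mul_nonneg (by positivity) (Finset.sum_nonneg fun i _ => ?_)
  cases S i with
  | none => exact le_rfl
  | some z => exact T.ℓ_nonneg θ hθ z

theorem minLoss_nonneg {n : ℕ} (S : Fin n → Option 𝒵) : 0 ≤ T.minLoss S := by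
  refine Real.sInf_nonneg ?_
  rintro _ ⟨θ, hθ, rfl⟩
  exact T.empLoss_nonneg hθ S

theorem minLossAt_nonneg (w : ℝ) {n : ℕ} (S : Fin n → Option 𝒵) : 0 ≤ T.minLossAt w S := by
  refine Real.sInf_nonneg ?_
  rintro _ ⟨θ, hθ, rfl⟩
  exact T.empLoss_nonneg hθ.1 S

theorem minLossOn_nonneg (π : Set ℝ) {n : ℕ} (S : Fin n → Option 𝒵) : 0 ≤ T.minLossOn π S := by
  refine Real.sInf_nonneg ?_
  rintro _ ⟨w, _, rfl⟩
  exact T.minLossAt_nonneg w S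

theorem minLossOn_le {π : Set ℝ} {w : ℝ} (hw : w ∈ π) {n : ℕ} (S : Fin n → Option 𝒵) :
    T.minLossOn π S ≤ T.minLossAt w S := by
  refine csInf_le ⟨0, ?_⟩ ⟨w, hw, rfl⟩
  rintro _ ⟨w', _, rfl⟩
  exact T.minLossAt_nonneg w' S

theorem le_minLossOn {π : Set ℝ} (hπ : π.Nonempty) {n : ℕ} (S : Fin n → Option 𝒵) {x : ℝ}
    (hx : ∀ w ∈ π, x ≤ T.minLossAt w S) : x ≤ T.minLossOn π S := by
  refine le_csInf (hπ.image _) ?_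
  rintro _ ⟨w, hw, rfl⟩
  exact hx w hw

theorem sInf_image_const_mul {α : Type*} {c : ℝ} (hc : 0 ≤ c) (g : α → ℝ) (s : Set α) :
    sInf ((fun a => c * g a) '' s) = c * sInf (g '' s) := by
  rw [← smul_eq_mul c (sInf _), ← Real.sInf_smul_of_nonneg hc, ← Set.image_smul, Set.image_image]
  simp

section Scaling

variable {n m : ℕ} {S : Fin n → Option 𝒵} {Z : Fin m → 𝒵}

/-- Entries ⊥ contribute nothing but are counted in the normalization, so dropping them only
rescales. The hypothesis covers both subsampling and removal of a point. -/
theorem empLoss_eq_of_sum_eq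
    (h : ∀ θ, ∑ i, T.lossBot θ (S i) = ∑ k, T.ℓ θ (Z k)) (θ : Fin (d + 1) → ℝ) :
    T.empLoss θ S = (m / n : ℝ) * T.empLoss θ (full Z) := by
  have hZ : ∑ k, T.lossBot θ (full Z k) = ∑ k, T.ℓ θ (Z k) := rfl
  rw [empLoss, empLoss, h, hZ]
  rcases Nat.eq_zero_or_pos m with rfl | hm
  · simp
  · field_simp

theorem minLoss_eq_of_sum_eq (h : ∀ θ, ∑ i, T.lossBot θ (S i) = ∑ k, T.ℓ θ (Z k)) :
    T.minLoss S = (m / n : ℝ) * T.minLoss (full Z) := by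
  simp only [minLoss, T.empLoss_eq_of_sum_eq h]
  exact sInf_image_const_mul (by positivity) _ _

theorem minLossAt_eq_of_sum_eq (h : ∀ θ, ∑ i, T.lossBot θ (S i) = ∑ k, T.ℓ θ (Z k)) (w : ℝ) :
    T.minLossAt w S = (m / n : ℝ) * T.minLossAt w (full Z) := by
  simp only [minLossAt, T.empLoss_eq_of_sum_eq h]
  exact sInf_image_const_mul (by positivity) _ _

end Scaling

theorem sum_lossBot_remove {m : ℕ} (Z : Fin (m + 1) → 𝒵) (i : Fin (m + 1))
    (θ : Fin (d + 1) → ℝ) :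
    ∑ j, T.lossBot θ (remove Z i j) = ∑ k, T.ℓ θ (Z (i.succAbove k)) := by
  rw [Fin.sum_univ_succAbove _ i]
  simp [remove, lossBot, full]

/-- The enumeration of the indices kept by a bit vector. -/
def keptIndex {n : ℕ} (b : Fin n → Bool) : Fin (Fintype.card {i // b i = true}) → Fin n :=
  fun k => ((Fintype.equivFin {i // b i = true}).symm k).1

theorem keptIndex_injective {n : ℕ} (b : Fin n → Bool) : Function.Injective (keptIndex b) :=
  Subtype.val_injective.comp (Equiv.injective _)

theorem sum_lossBot_subsample {n : ℕ} (Z : Fin n → 𝒵) (b : Fin n → Bool)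
    (θ : Fin (d + 1) → ℝ) :
    ∑ i, T.lossBot θ (subsample Z b i) = ∑ k, T.ℓ θ (Z (keptIndex b k)) := by
  have h1 : ∑ k, T.ℓ θ (Z (keptIndex b k)) = ∑ i : {i // b i = true}, T.ℓ θ (Z i.1) :=
    Equiv.sum_comp (Fintype.equivFin {i // b i = true}).symm fun i => T.ℓ θ (Z i.1)
  have h2 : ∀ i, T.lossBot θ (subsample Z b i) = if b i = true then T.ℓ θ (Z i) else 0 :=
    fun i => by
      unfold subsample
      split_ifs <;> rfl
  rw [h1, Finset.sum_congr rfl fun i _ => h2 i, ← Finset.sum_filter]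
  exact Finset.sum_subtype _ (by simp) _

/-! ### The truncated loss and its increments. -/

/-- The unnormalized smallest loss, truncated at level `R`. -/
def truncLoss (R : ℝ) {m : ℕ} (Z : Fin m → 𝒵) : ℝ := min (m * T.minLoss (full Z)) R

/-- The mean of the truncated loss over `m` samples. -/
def meanTruncLoss (R : ℝ) (m : ℕ) : ℝ := ∫ Z, T.truncLoss R Z ∂(T.sampleLaw m)

theorem truncLoss_nonneg {R : ℝ} (hR : 0 ≤ R) {m : ℕ} (Z : Fin m → 𝒵) : 0 ≤ T.truncLoss R Z :=
  le_min (mul_nonneg (Nat.cast_nonneg _) (T.minLoss_nonneg _)) hR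

theorem truncLoss_le (R : ℝ) {m : ℕ} (Z : Fin m → 𝒵) : T.truncLoss R Z ≤ R := min_le_right _ _

theorem aemeasurable_truncLoss
    (hL : ∀ n : ℕ, AEMeasurable (fun Z => T.minLoss (full Z)) (T.sampleLaw n)) (R : ℝ) (m : ℕ) :
    AEMeasurable (fun Z => T.truncLoss R Z) (T.sampleLaw m) :=
  ((hL m).const_mul _).min aemeasurable_const

/-- The change of the truncated loss when a data point is removed. -/
def truncLossIncrement (R : ℝ) {m : ℕ} (i : Fin (m + 1)) (Z : Fin (m + 1) → 𝒵) : ℝ :=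
  |T.truncLoss R Z - T.truncLoss R fun k => Z (i.succAbove k)|

theorem truncLossIncrement_le {R : ℝ} (hR : 0 ≤ R) {m : ℕ} (i : Fin (m + 1))
    (Z : Fin (m + 1) → 𝒵) : T.truncLossIncrement R i Z ≤ R := by
  have h1 := T.truncLoss_nonneg hR Z
  have h2 := T.truncLoss_nonneg hR fun k => Z (i.succAbove k)
  exact abs_le.2 ⟨by linarith [T.truncLoss_le R fun k => Z (i.succAbove k)],
    by linarith [T.truncLoss_le R Z]⟩

/-- Without normalization, the loss of the m remaining points is (m + 1) times the loss of `remove Z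
i`, and truncation is 1-Lipschitz. -/
theorem truncLossIncrement_le_stability (R : ℝ) {m : ℕ} (i : Fin (m + 1)) (Z : Fin (m + 1) → 𝒵) :
    T.truncLossIncrement R i Z
      ≤ (m + 1 : ℕ) * |T.minLoss (full Z) - T.minLoss (remove Z i)| := by
  have h := T.minLoss_eq_of_sum_eq (T.sum_lossBot_remove Z i)
  have h2 : (m : ℝ) * T.minLoss (full fun k => Z (i.succAbove k))
      = (m + 1 : ℕ) * T.minLoss (remove Z i) := by
    rw [h]; push_cast; field_simp
  have h3 := abs_min_sub_min_le_max ((m + 1 : ℕ) * T.minLoss (full Z)) R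
    (m * T.minLoss (full fun k => Z (i.succAbove k))) R
  rw [sub_self, abs_zero, max_eq_left (abs_nonneg _), h2, ← mul_sub, abs_mul, Nat.abs_cast] at h3
  rwa [← h2] at h3

theorem measurePreserving_succAbove {m : ℕ} (i : Fin (m + 1)) :
    MeasurePreserving (fun (Z : Fin (m + 1) → 𝒵) k => Z (i.succAbove k)) (T.sampleLaw (m + 1))
      (T.sampleLaw m) := by
  have := T.isProbabilityMeasure_D
  exact measurePreserving_comp_injective T.D Fin.succAbove_right_injective

theorem aemeasurable_truncLossIncrement
    (hL : ∀ n : ℕ, AEMeasurable (fun Z => T.minLoss (full Z)) (T.sampleLaw n)) (R : ℝ) {m : ℕ}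
    (i : Fin (m + 1)) : AEMeasurable (T.truncLossIncrement R i) (T.sampleLaw (m + 1)) := by
  have h := (T.aemeasurable_truncLoss hL R m).comp_quasiMeasurePreserving
    (T.measurePreserving_succAbove i).quasiMeasurePreserving
  exact ((T.aemeasurable_truncLoss hL R (m + 1)).sub h).norm

/-! ### Concentration of the truncated loss and regularity of its mean. -/

section Concentration

variable {T} {θhat : (n : ℕ) → (Fin n → 𝒵) → (Fin (d + 1) → ℝ)} {θD : Fin (d + 1) → ℝ}
  {N : ℝ → ℝ} {M K lam μ σ : ℝ}

/-- Stability at confidence 2e^(-s), where log(2/β) = s: the 1/n in its bound cancels the sample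
count, leaving an exponential tail of scale `L`. -/
theorem IdentConcStab.measure_truncLossIncrement_ge_le
    (H : T.IdentConcStab θhat θD N M K lam μ σ) {L : ℝ} (hL : lam ≤ L) (R : ℝ) {m : ℕ}
    (i : Fin (m + 1)) {s : ℝ} (hs : 0 ≤ s) (hm : M + K * s ≤ (m + 1 : ℕ)) :
    T.sampleLaw (m + 1) {Z | s ≤ T.truncLossIncrement R i Z / L}
      ≤ ENNReal.ofReal (2 * Real.exp (-s)) := by
  have hL0 : 0 < L := H.lam_pos.trans_le hL
  have hlog : Real.log (2 / (2 * Real.exp (-s))) = s := by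
    rw [show 2 / (2 * Real.exp (-s)) = Real.exp s by rw [Real.exp_neg]; field_simp, Real.log_exp]
  have hlog1 : Real.log (1 / (2 * Real.exp (-s))) ≤ s := by
    conv_rhs => rw [← hlog]
    gcongr
    norm_num
  refine le_trans (measure_mono fun Z hZ => ?_) (H.stability (2 * Real.exp (-s)) (by positivity)
    (m + 1) ((by gcongr; exact H.K_pos.le : _ ≤ M + K * s).trans hm) i)
  have hm0 : (0 : ℝ) < (m + 1 : ℕ) := by positivity
  show lam * Real.log (2 / (2 * Real.exp (-s))) / (m + 1 : ℕ) ≤ _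
  rw [hlog, div_le_iff₀ hm0]
  have h1 : s * L ≤ T.truncLossIncrement R i Z := (le_div_iff₀ hL0).1 hZ
  nlinarith [T.truncLossIncrement_le_stability R i Z]

/-- The sample size gives the tail only up to `s₀`; beyond that the truncation level `R` caps the
increment, and `hRL` makes this range negligible. -/
theorem IdentConcStab.integral_truncLossIncrement_pow_le
    (H : T.IdentConcStab θhat θD N M K lam μ σ)
    (hmeas : ∀ n : ℕ, AEMeasurable (fun Z => T.minLoss (full Z)) (T.sampleLaw n))
    {L R s₀ : ℝ} (hL : lam ≤ L) (hR : 0 ≤ R) (hs₀ : 0 ≤ s₀) {k : ℕ} (hk : 0 < k)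
    (hRL : (R / L) ^ k * (2 * Real.exp (-s₀)) ≤ 1) {m : ℕ} (i : Fin (m + 1))
    (hm : M + K * s₀ ≤ (m + 1 : ℕ)) :
    ∫ Z, T.truncLossIncrement R i Z ^ k ∂(T.sampleLaw (m + 1))
      ≤ L ^ k * (2 * k.factorial + 1) := by
  have := T.isProbabilityMeasure_sampleLaw (m + 1)
  have hL0 : 0 < L := H.lam_pos.trans_le hL
  have h := integral_pow_le_of_tail (P := T.sampleLaw (m + 1))
    (D := fun Z => T.truncLossIncrement R i Z / L) (b := R / L) (s₀ := s₀)
    ((T.aemeasurable_truncLossIncrement hmeas R i).div_const L)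
    (fun Z => div_nonneg (abs_nonneg _) hL0.le)
    (fun Z => by gcongr; exact T.truncLossIncrement_le hR i Z)
    (fun s hs hss => H.measure_truncLossIncrement_ge_le hL R i hs
      ((by gcongr; exact H.K_pos.le : M + K * s ≤ M + K * s₀).trans hm)) hk hs₀ hRL
  simp only [div_pow] at h
  rw [integral_div, div_le_iff₀ (by positivity)] at h
  linarith

/-- Couple the two sample sizes by deleting a point; the first moment of the increment is at most
L(2·1! + 1) = 3L. -/
theorem IdentConcStab.abs_meanTruncLoss_succ_sub_le
    (H : T.IdentConcStab θhat θD N M K lam μ σ)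
    (hmeas : ∀ n : ℕ, AEMeasurable (fun Z => T.minLoss (full Z)) (T.sampleLaw n))
    {L R s₀ : ℝ} (hL : lam ≤ L) (hR : 0 ≤ R) (hs₀ : 0 ≤ s₀)
    (hRL : R / L * (2 * Real.exp (-s₀)) ≤ 1) {m : ℕ} (hm : M + K * s₀ ≤ (m + 1 : ℕ)) :
    |T.meanTruncLoss R (m + 1) - T.meanTruncLoss R m| ≤ 3 * L := by
  have hi (j : ℕ) : Integrable (fun Z => T.truncLoss R Z) (T.sampleLaw j) := by
    have := T.isProbabilityMeasure_sampleLaw j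
    refine Integrable.of_bound (T.aemeasurable_truncLoss hmeas R j).aestronglyMeasurable R
      (Filter.Eventually.of_forall fun Z => ?_)
    rw [Real.norm_eq_abs, abs_of_nonneg (T.truncLoss_nonneg hR Z)]
    exact T.truncLoss_le R Z
  have hp := T.measurePreserving_succAbove (m := m) 0
  have hi2 : Integrable (fun Z : Fin (m + 1) → 𝒵 =>
      T.truncLoss R fun k => Z ((0 : Fin (m + 1)).succAbove k)) (T.sampleLaw (m + 1)) := hp.integrable_comp_of_integrable (hi m)
  have h1 : T.meanTruncLoss R m
      = ∫ Z, (T.truncLoss R fun k => Z ((0 : Fin (m + 1)).succAbove k)) ∂(T.sampleLaw (m + 1)) := by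
    have := integral_map (μ := T.sampleLaw (m + 1)) (f := fun Z : Fin m → 𝒵 => T.truncLoss R Z)
      hp.measurable.aemeasurable (by rw [hp.map_eq]; exact (hi m).aestronglyMeasurable)
    rw [hp.map_eq] at this
    exact this
  rw [h1, meanTruncLoss, ← integral_sub (hi (m + 1)) hi2]
  refine abs_integral_le_integral_abs.trans ?_
  have h2 := H.integral_truncLossIncrement_pow_le hmeas hL hR hs₀ one_pos (by simpa using hRL)
    (0 : Fin (m + 1)) hm
  simp only [pow_one, Nat.factorial_one, Nat.cast_one] at h2
  exact h2.trans (by linarith)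

/-- Telescoping. It lets the centre be independent of the random number of kept points. -/
theorem IdentConcStab.abs_meanTruncLoss_sub_le
    (H : T.IdentConcStab θhat θD N M K lam μ σ)
    (hmeas : ∀ n : ℕ, AEMeasurable (fun Z => T.minLoss (full Z)) (T.sampleLaw n))
    {L R s₀ : ℝ} (hL : lam ≤ L) (hR : 0 ≤ R) (hs₀ : 0 ≤ s₀)
    (hRL : R / L * (2 * Real.exp (-s₀)) ≤ 1) {m m' : ℕ} (hm : M + K * s₀ ≤ m)
    (hm' : M + K * s₀ ≤ m') :
    |T.meanTruncLoss R m - T.meanTruncLoss R m'| ≤ 3 * L * |(m : ℝ) - m'| := by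
  have key : ∀ (j l : ℕ), M + K * s₀ ≤ l →
      |T.meanTruncLoss R (l + j) - T.meanTruncLoss R l| ≤ 3 * L * j := by
    intro j
    induction j with
    | zero => intro l _; simp
    | succ j ih =>
      intro l hl
      have h1 := H.abs_meanTruncLoss_succ_sub_le hmeas hL hR hs₀ hRL (m := l + j)
        (hl.trans (by push_cast; linarith [(Nat.cast_nonneg j : (0:ℝ) ≤ j)]))
      have h2 := ih l hl
      have h3 := abs_sub_le (T.meanTruncLoss R (l + j + 1)) (T.meanTruncLoss R (l + j))
        (T.meanTruncLoss R l)
      push_cast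
      rw [← add_assoc]
      linarith
  rcases le_total m' m with h | h
  · obtain ⟨j, rfl⟩ := Nat.exists_eq_add_of_le h
    simpa using key j m' hm'
  · obtain ⟨j, rfl⟩ := Nat.exists_eq_add_of_le h
    rw [abs_sub_comm, abs_sub_comm (m : ℝ)]
    simpa using key j m hm

/-- Two samples differing in coordinate i agree once that point is deleted, so resampling costs at
most the sum of their two removal increments. -/
theorem IdentConcStab.measure_truncLoss_deviation_le
    (H : T.IdentConcStab θhat θD N M K lam μ σ)
    (hmeas : ∀ n : ℕ, AEMeasurable (fun Z => T.minLoss (full Z)) (T.sampleLaw n))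
    {L R s₀ t : ℝ} (hL : lam ≤ L) (hR : 0 ≤ R) (hs₀ : 0 ≤ s₀) {q m : ℕ} (hq : 0 < q)
    (hqm : q ≤ m) (hRL : (R / L) ^ (2 * q) * (2 * Real.exp (-s₀)) ≤ 1)
    (hm : M + K * s₀ ≤ m) (ht : 0 < t) (htL : 144 * Real.exp 9 * q ^ 3 * m * L ^ 2 ≤ t ^ 2) :
    T.sampleLaw m {Z | t ≤ |T.truncLoss R Z - T.meanTruncLoss R m|}
      ≤ ENNReal.ofReal (6 * m * Real.exp (-(8 * q))) := by
  obtain ⟨m, rfl⟩ : ∃ m', m = m' + 1 := ⟨m - 1, by omega⟩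
  have := T.isProbabilityMeasure_D
  refine measure_abs_sub_mean_ge_le T.D hq hqm (B := R) (B' := R)
    (T.aemeasurable_truncLoss hmeas R (m + 1))
    (fun Z => by
      rw [abs_of_nonneg (T.truncLoss_nonneg hR Z)]
      exact T.truncLoss_le R Z)
    (T.truncLossIncrement R) (T.aemeasurable_truncLossIncrement hmeas R)
    (fun i Z => abs_nonneg _) (fun i Z => T.truncLossIncrement_le hR i Z) (fun i Z x => ?_)
    (fun i => H.integral_truncLossIncrement_pow_le hmeas hL hR hs₀ (by omega) hRL i hm) ht htL
  have : (fun k => Function.update Z i x (i.succAbove k)) = fun k => Z (i.succAbove k) := by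
    funext k
    exact Function.update_of_ne (Fin.succAbove_ne i k) _ _
  simp only [truncLossIncrement, this]
  rw [abs_sub_comm (T.truncLoss R (Function.update Z i x))]
  exact abs_sub_le _ _ _

end Concentration

end LearningTask

/-! ### Separation of intervals on the typical event, and its probability. -/

namespace LearningTask

/-- The clipped losses of a subsample, given that the kept data points are typical. -/
theorem clippedLossOn_subsample_of_typical {𝒵 : Type*} [MeasurableSpace 𝒵] {d : ℕ}
    (T : LearningTask 𝒵 d) {θhat : (n : ℕ) → (Fin n → 𝒵) → (Fin (d + 1) → ℝ)}
    {θD : Fin (d + 1) → ℝ} {μ σ p α ρ A X : ℝ} (hμ : 0 < μ) (hp0 : 0 < p) (hp : p < 1 / 4)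
    (hα : 0 < α) (hρ : 2 * σ ^ 2 + α ^ 2 ≤ ρ) {n : ℕ} (hn : 0 < n) (hX : X = p * n)
    (b : Fin n → Bool) (Z : Fin n → 𝒵) {m : ℕ} {Z' : Fin m → 𝒵}
    (hS : ∀ θ, ∑ i, T.lossBot θ (subsample Z b i) = ∑ k, T.ℓ θ (Z' k))
    (hm1 : 9 / 10 * X ≤ m) (hm2 : m ≤ 11 / 10 * X)
    (hθ : |θhat m Z' 0 - θD 0| < α / 2 / √μ)
    (hid : ∀ w ∈ T.firstCoords,
      μ * (w - θhat m Z' 0) ^ 2 / 2 ≤ T.minLossAt w (full Z') - T.minLoss (full Z') ∧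
      T.minLossAt w (full Z') - T.minLoss (full Z') ≤ 2 * μ * (w - θhat m Z' 0) ^ 2)
    (hF : m * T.minLoss (full Z') ≤ 13 / 10 * X * σ ^ 2)
    (hA : |m * T.minLoss (full Z') - A| ≤ α ^ 2 / 10 * X)
    {π : Set ℝ} (hπ : π.Nonempty) (hπT : π ⊆ T.firstCoords) :
    (10 * α / √μ ≤ Metric.infDist (θD 0) π →
      A / X - α ^ 2 / 5 + 3 * α ^ 2 < T.clippedLossOn p ρ π (subsample Z b)) ∧
    (θD 0 ∈ π →
      A / X - α ^ 2 / 5 < T.clippedLossOn p ρ π (subsample Z b) ∧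
      T.clippedLossOn p ρ π (subsample Z b) < A / X - α ^ 2 / 5 + α ^ 2) := by
  have hn' : (0 : ℝ) < n := by exact_mod_cast hn
  have hX0 : 0 < X := by rw [hX]; positivity
  have hα2 : 0 < α ^ 2 := by positivity
  have hsμ : 0 < √μ := Real.sqrt_pos.2 hμ
  have hsμ2 : √μ ^ 2 = μ := Real.sq_sqrt hμ.le
  set l := T.minLoss (full Z') with hl
  set r : ℝ := m / X with hr
  have hr1 : 9 / 10 ≤ r := (le_div_iff₀ hX0).2 hm1
  have hr2 : r ≤ 11 / 10 := (div_le_iff₀ hX0).2 hm2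
  have hmn : (m : ℝ) / n = p * r := by rw [hr, hX]; field_simp
  have hrl : m * l = X * (r * l) := by rw [hr]; field_simp
  rw [hrl] at hF hA
  have hF' : r * l ≤ 13 / 10 * σ ^ 2 := by
    refine le_of_mul_le_mul_left ?_ hX0
    linarith
  have hA' : |r * l - A / X| ≤ α ^ 2 / 10 := by
    have : r * l - A / X = (X * (r * l) - A) / X := by field_simp
    rw [this, abs_div, abs_of_pos hX0, div_le_iff₀ hX0]
    exact hA
  obtain ⟨hA1, hA2⟩ := abs_le.1 hA'
  have hl0 : 0 ≤ l := T.minLoss_nonneg _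
  have hat : ∀ w, T.minLossAt w (subsample Z b) = p * (r * T.minLossAt w (full Z')) := fun w => by
    rw [T.minLossAt_eq_of_sum_eq hS, hmn, mul_assoc]
  obtain ⟨y, hy⟩ : ∃ y, T.minLossOn π (subsample Z b) = p * y :=
    ⟨T.minLossOn π (subsample Z b) / p, by field_simp⟩
  have hy0 : 0 ≤ p * y := hy ▸ T.minLossOn_nonneg π _
  have hclip : T.clippedLossOn p ρ π (subsample Z b) = min y (ρ / p) := by
    have hρ0 : 0 ≤ ρ := le_trans (by positivity) hρ
    rw [clippedLossOn, hy, max_eq_right (le_min hy0 hρ0),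
      show min (p * y) ρ = p * min y (ρ / p) by
        rw [mul_min_of_nonneg _ _ hp0.le, mul_div_cancel₀ _ hp0.ne']]
    field_simp
  -- The upper clip sits at ρ/p ≥ 8σ² + 4α²: above every loss to be read off exactly, and above the
  -- threshold for distant intervals.
  have hρp : 4 * ρ ≤ ρ / p := by
    have hρ0 : 0 ≤ ρ := le_trans (by positivity) hρ
    rw [le_div_iff₀ hp0]
    nlinarith
  have hlow : ∀ x, (∀ w ∈ π, x ≤ r * T.minLossAt w (full Z')) → x ≤ y := fun x hx => by
    refine le_of_mul_le_mul_left ?_ hp0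
    rw [← hy]
    refine T.le_minLossOn hπ _ fun w hw => ?_
    rw [hat]
    exact mul_le_mul_of_nonneg_left (hx w hw) hp0.le
  have hσ : 0 ≤ σ ^ 2 := sq_nonneg σ
  rw [hclip]
  constructor
  · intro hfar
    -- Distance 10 - 1/2 = 19/2 from the empirical minimizer, in units α/√μ, costs 361/8 α²;
    -- multiplied by r ≥ 9/10 this exceeds 40α².
    have hy1 : r * l + 40 * α ^ 2 ≤ y := by
      refine hlow _ fun w hw => ?_
      have h1 : 10 * α / √μ ≤ |θD 0 - w| := by
        rw [← Real.dist_eq]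
        exact hfar.trans (Metric.infDist_le_dist_of_mem hw)
      have h2 : 19 / 2 * α / √μ ≤ |w - θhat m Z' 0| := by
        have h3 := abs_sub_le (θD 0) (θhat m Z' 0) w
        rw [abs_sub_comm (θD 0) (θhat m Z' 0), abs_sub_comm (θhat m Z' 0) w] at h3
        have h4 : 10 * α / √μ = 19 / 2 * α / √μ + α / 2 / √μ := by ring
        linarith
      have h5 : (19 / 2 * α / √μ) ^ 2 ≤ (w - θhat m Z' 0) ^ 2 := by
        rw [← sq_abs (w - θhat m Z' 0)]
        exact pow_le_pow_left₀ (by positivity) h2 2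
      have h6 : μ * (19 / 2 * α / √μ) ^ 2 = 361 / 4 * α ^ 2 := by
        rw [div_pow, hsμ2]; field_simp; ring
      have h7 := (hid w (hπT hw)).1
      have h8 : 361 / 8 * α ^ 2 ≤ T.minLossAt w (full Z') - l := by
        linarith [mul_le_mul_of_nonneg_left h5 hμ.le]
      have h9 := mul_le_mul hr1 h8 (by positivity) (by linarith)
      rw [mul_sub] at h9
      linarith
    refine lt_min (by linarith) ?_
    linarith
  · intro hmem
    have hy1 : r * l ≤ y := by
      refine hlow _ fun w hw => ?_
      have h7 := (hid w (hπT hw)).1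
      have h8 : 0 ≤ μ * (w - θhat m Z' 0) ^ 2 / 2 := by positivity
      have h9 : l ≤ T.minLossAt w (full Z') := by linarith
      gcongr
    -- The smoothness bound at distance α/(2√μ) gives α²/2, multiplied by r ≤ 11/10. With the
    -- concentration error α²/10, `y` stays strictly inside the window of width α² starting at A/X -
    -- α²/5.
    have hy2 : y ≤ r * l + 11 / 20 * α ^ 2 := by
      have h1 := T.minLossOn_le hmem (subsample Z b)
      rw [hy, hat] at h1
      have h2 := le_of_mul_le_mul_left h1 hp0
      have h3 := (hid _ (hπT hmem)).2
      have h5 : (θD 0 - θhat m Z' 0) ^ 2 ≤ (α / 2 / √μ) ^ 2 := by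
        rw [← sq_abs (θD 0 - θhat m Z' 0), abs_sub_comm]
        exact pow_le_pow_left₀ (abs_nonneg _) hθ.le 2
      have h6 : 2 * μ * (α / 2 / √μ) ^ 2 = α ^ 2 / 2 := by
        rw [div_pow, hsμ2]; field_simp
      have h8 : T.minLossAt (θD 0) (full Z') ≤ l + α ^ 2 / 2 := by
        linarith [mul_le_mul_of_nonneg_left h5 (by positivity : 0 ≤ 2 * μ)]
      have h9 := mul_le_mul_of_nonneg_left h8 (by linarith : 0 ≤ r)
      have h10 := mul_le_mul_of_nonneg_right hr2 hα2.le
      rw [mul_add] at h9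
      linarith
    rw [min_eq_left (by linarith)]
    exact ⟨by linarith, by linarith⟩

/-- The typical event for `m` data points, when the sample size suffices for every condition. -/
theorem IdentConcStab.measure_not_typical_le {𝒵 : Type*} [MeasurableSpace 𝒵] {d : ℕ}
    {T : LearningTask 𝒵 d} {θhat : (n : ℕ) → (Fin n → 𝒵) → (Fin (d + 1) → ℝ)}
    {θD : Fin (d + 1) → ℝ} {N : ℝ → ℝ} {M K lam μ σ : ℝ}
    (H : T.IdentConcStab θhat θD N M K lam μ σ) {α β Λ : ℝ} (hα : 0 < α) (hβ : 0 < β)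
    (hΛ : Real.log (8 / β) ≤ 3 * Λ) {m : ℕ} (hm : 0 < m)
    (h1 : N (α / 2) + 12 * (K * Λ / α ^ 2) ≤ m) (h2 : M + 3 * (K * Λ) ≤ m)
    (h3 : 30 * Λ ≤ m) {R t A : ℝ}
    (hdev : T.sampleLaw m {Z | t ≤ |T.truncLoss R Z - A|} ≤ ENNReal.ofReal (β / 8)) :
    T.sampleLaw m {Z | ¬ (|θhat m Z 0 - θD 0| < α / 2 / √μ ∧
      (∀ w ∈ T.firstCoords,
        μ * (w - θhat m Z 0) ^ 2 / 2 ≤ T.minLossAt w (full Z) - T.minLoss (full Z) ∧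
        T.minLossAt w (full Z) - T.minLoss (full Z) ≤ 2 * μ * (w - θhat m Z 0) ^ 2) ∧
      T.minLoss (full Z) ≤ 11 / 10 * σ ^ 2 ∧ |T.truncLoss R Z - A| ≤ t)}
      ≤ ENNReal.ofReal (β / 2) := by
  have hm' : (0 : ℝ) < m := by exact_mod_cast hm
  have hK := H.K_pos
  have e : 1 / (β / 8) = 8 / β := by field_simp
  have hβ8 : 0 < β / 8 := by positivity
  -- Accuracy α/2 costs a factor 4 and log(8/β) ≤ 3Λ a factor 3, whence 12. Each of the four
  -- failures gets β/8.
  have p1 := H.param_concentration (α / 2) (β / 8) (by positivity) hβ8 m (by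
    rw [e]
    refine le_trans ?_ h1
    have : K * Real.log (8 / β) / (α / 2) ^ 2 ≤ K * (3 * Λ) / (α / 2) ^ 2 := by gcongr
    have e2 : K * (3 * Λ) / (α / 2) ^ 2 = 12 * (K * Λ / α ^ 2) := by field_simp; ring
    linarith)
  have p2 := H.identifiability (β / 8) hβ8 m (by
    rw [e]
    nlinarith)
  have p3 := H.tail_bound (β / 8) hβ8 m hm
  rw [e] at p3
  have hsub : {Z | ¬ (|θhat m Z 0 - θD 0| < α / 2 / √μ ∧
      (∀ w ∈ T.firstCoords,
        μ * (w - θhat m Z 0) ^ 2 / 2 ≤ T.minLossAt w (full Z) - T.minLoss (full Z) ∧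
        T.minLossAt w (full Z) - T.minLoss (full Z) ≤ 2 * μ * (w - θhat m Z 0) ^ 2) ∧
      T.minLoss (full Z) ≤ 11 / 10 * σ ^ 2 ∧ |T.truncLoss R Z - A| ≤ t)}
      ⊆ (({Z | α / 2 / √μ ≤ |θhat m Z 0 - θD 0|} ∪ {Z | ¬ ∀ w ∈ T.firstCoords,
        μ * (w - θhat m Z 0) ^ 2 / 2 ≤ T.minLossAt w (full Z) - T.minLoss (full Z) ∧
        T.minLossAt w (full Z) - T.minLoss (full Z) ≤ 2 * μ * (w - θhat m Z 0) ^ 2})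
        ∪ {Z | σ ^ 2 * (1 + Real.log (8 / β) / m) ≤ T.minLoss (full Z)})
        ∪ {Z | t ≤ |T.truncLoss R Z - A|} := by
    intro Z hZ
    by_contra hc
    simp only [Set.mem_union, not_or] at hc
    obtain ⟨⟨⟨c1, c2⟩, c3⟩, c4⟩ := hc
    refine hZ ⟨lt_of_not_ge c1, not_not.1 c2, ?_, (lt_of_not_ge c4).le⟩
    refine (lt_of_not_ge c3).le.trans ?_
    have : Real.log (8 / β) / m ≤ 1 / 10 := by
      rw [div_le_iff₀ hm']
      linarith
    nlinarith [sq_nonneg σ]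
  refine (measure_mono hsub).trans ?_
  refine (measure_union_le _ _).trans ((add_le_add ((measure_union_le _ _).trans
    (add_le_add ((measure_union_le _ _).trans (add_le_add p1 p2)) p3)) hdev).trans ?_)
  rw [← ENNReal.ofReal_add, ← ENNReal.ofReal_add, ← ENNReal.ofReal_add]
  · apply ENNReal.ofReal_le_ofReal
    linarith
  all_goals positivity

end LearningTask

/-! ### Numerical estimates. -/

theorem exp_nine_le : Real.exp 9 ≤ 8200 := by
  calc Real.exp 9 = Real.exp 1 ^ 9 := by rw [← Real.exp_nat_mul]; norm_num
    _ ≤ 2.72 ^ 9 := by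
      gcongr
      exact (Real.exp_one_lt_d9.trans (by norm_num)).le
    _ ≤ 8200 := by norm_num

/-- All five follow from nx/β ≥ 2n/β, whose logarithm splits into log 2, log n and log(1/β), all
nonnegative. -/
theorem log_mul_div_bounds {n β x : ℝ} (hn : 1 ≤ n) (hβ0 : 0 < β) (hβ1 : β < 1) (hx : 2 ≤ x) :
    1 / 2 ≤ Real.log (n * x / β) ∧ Real.log n ≤ Real.log (n * x / β) ∧
      Real.log 2 ≤ Real.log (n * x / β) ∧ Real.log (8 / β) ≤ 3 * Real.log (n * x / β) ∧
      Real.exp (-Real.log (n * x / β)) ≤ β / (2 * n) := by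
  have hle : 2 * n / β ≤ n * x / β := by
    rw [mul_comm 2 n]
    gcongr
  have h1 : Real.log (2 * n / β) ≤ Real.log (n * x / β) := Real.log_le_log (by positivity) hle
  have h2 : Real.log (2 * n / β) = Real.log 2 + Real.log n + Real.log (1 / β) := by
    rw [← Real.log_mul (by norm_num) (by positivity), ← Real.log_mul (by positivity)
      (by positivity)]
    ring_nf
  have hlogn : 0 ≤ Real.log n := Real.log_nonneg hn
  have hlogβ : 0 ≤ Real.log (1 / β) := Real.log_nonneg ((one_le_div hβ0).2 hβ1.le)
  have hlog2 := Real.log_two_gt_d9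
  have hlog8 : Real.log (8 / β) = 3 * Real.log 2 + Real.log (1 / β) := by
    rw [show (8 : ℝ) / β = 2 ^ 3 * (1 / β) by ring, Real.log_mul (by positivity) (by positivity),
      Real.log_pow]
    norm_num
  refine ⟨by linarith, by linarith, by linarith, by linarith, ?_⟩
  rw [Real.exp_neg, ← one_div, one_div_le (Real.exp_pos _) (by positivity), one_div_div,
    ← Real.exp_log (by positivity : 0 < 2 * n / β)]
  exact Real.exp_le_exp.2 h1

/-- Absorbs lower powers of the logarithm into its cube. -/
theorem le_mul_cube_of_half_le {x : ℝ} (hx : 1 / 2 ≤ x) : x ≤ 4 * x ^ 3 ∧ x ^ 2 ≤ 2 * x ^ 3 := by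
  have h : 0 ≤ x * (x - 1 / 2) := mul_nonneg (by linarith) (by linarith)
  constructor <;> nlinarith

end

/-! ### Choice of parameters and assembly. -/

set_option maxHeartbeats 2000000 in
theorem lemma5p5 :
    ∃ C : ℝ, 0 < C ∧
      ∀ (𝒵 : Type*) [MeasurableSpace 𝒵] (d : ℕ) (T : LearningTask 𝒵 d)
        (θhat : (n : ℕ) → (Fin n → 𝒵) → (Fin (d + 1) → ℝ)) (θD : Fin (d + 1) → ℝ)
        (N : ℝ → ℝ) (M K lam μ σ : ℝ),
        (∀ n : ℕ, AEMeasurable (fun Z => T.minLoss (LearningTask.full Z)) (T.sampleLaw n)) →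
        T.IsEmpMinimizer θhat → T.IsPopMinimizer θD →
        T.IdentConcStab θhat θD N M K lam μ σ →
      ∀ (p α β ρ : ℝ), 0 < p → p < 1 / 4 → 0 < α → 0 < β → 2 * σ ^ 2 + α ^ 2 ≤ ρ →
      ∀ (κ : ℕ) (π : Fin κ → Set ℝ), LearningTask.IsIntervalPartition T.firstCoords π →
      ∃ h : (n : ℕ) → (Fin n → 𝒵) → ℝ, ∀ n : ℕ,
        C * ((N (α / 2) + M) / p +
            (K * (1 + α ^ 2) / (α ^ 2 * p) + (ρ ^ 2 + lam ^ 2) / (α ^ 4 * p)) *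
              Real.log (n * max (ρ * κ) 2 / β) ^ 3) ≤ (n : ℝ) →
        T.subsampleLaw p n {ω | ¬ ∀ j : Fin κ,
          (10 * α / √μ ≤ Metric.infDist (θD 0) (π j) →
            h n ω.1 + 3 * α ^ 2
              < T.clippedLossOn p ρ (π j) (LearningTask.subsample ω.1 ω.2)) ∧
          (θD 0 ∈ π j →
            h n ω.1 < T.clippedLossOn p ρ (π j) (LearningTask.subsample ω.1 ω.2) ∧
            T.clippedLossOn p ρ (π j) (LearningTask.subsample ω.1 ω.2)
              < h n ω.1 + α ^ 2)} ≤ ENNReal.ofReal β := by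
  refine ⟨10 ^ 12, by norm_num, ?_⟩
  intro 𝒵 _ d T θhat θD N M K lam μ σ hmeas _ _ H p α β ρ hp0 hp hα hβ hρ κ π hπ
  -- The centre is constant in the data. The shift α²/5 is twice the concentration error, which
  -- makes the lower inequality strict.
  refine ⟨fun n _ => T.meanTruncLoss (ρ * n) ⌈p * n⌉₊ / (p * n) - α ^ 2 / 5, fun n hn => ?_⟩
  have hM := H.M_pos
  have hK := H.K_pos
  have hlam := H.lam_pos
  have hN := H.N_nonneg (α / 2) (by positivity)
  have hp1 : p ≤ 1 := by linarith
  rcases le_or_gt 1 β with hβ1 | hβ1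
  · have := LearningTask.isProbabilityMeasure_bern hp0.le hp1
    have := T.isProbabilityMeasure_sampleLaw n
    have : IsProbabilityMeasure (T.subsampleLaw p n) := by
      unfold LearningTask.subsampleLaw
      infer_instance
    exact prob_le_one.trans (ENNReal.one_le_ofReal.2 hβ1)
  have hα2 : 0 < α ^ 2 := by positivity
  have hρα : α ^ 2 ≤ ρ := by linarith [sq_nonneg σ]
  have hρ0 : 0 < ρ := by linarith
  have hn0 : 0 < n := by
    -- For n = 0 the logarithm is log 0 = 0 by convention, and the sample size condition fails
    -- because M > 0.
    rcases Nat.eq_zero_or_pos n with rfl | h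
    · simp at hn
      have : 0 < (N (α / 2) + M) / p := by positivity
      linarith
    · exact h
  have hn1 : (1 : ℝ) ≤ n := by exact_mod_cast hn0
  have hx2 := le_max_right (ρ * κ) 2
  obtain ⟨hΛ2, hlogn', hlog2, hlog8, hexpΛ⟩ := log_mul_div_bounds hn1 hβ hβ1 hx2
  set Λ := Real.log (n * max (ρ * κ) 2 / β) with hΛ
  have hΛ0 : 0 < Λ := by linarith
  have hlogn : 0 ≤ Real.log n := Real.log_nonneg hn1
  have hβn2 : β / (2 * n) ≤ 1 / 2 := by
    rw [div_le_div_iff₀ (by positivity) (by norm_num)]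
    linarith
  have hΛ3 : 0 < Λ ^ 3 := by positivity
  obtain ⟨hΛΛ, hΛΛ2⟩ := le_mul_cube_of_half_le hΛ2
  -- the sample size
  set X : ℝ := p * n with hX
  have hX0 : 0 < X := by positivity
  have hXn : 4 * X ≤ n := by rw [hX, ← mul_assoc]; exact mul_le_of_le_one_left (by positivity) (by linarith)
  have hbig : 10 ^ 12 * ((N (α / 2) + M) + (K / α ^ 2 + K + (ρ ^ 2 + lam ^ 2) / α ^ 4) * Λ ^ 3)
      ≤ X := by
    have h1 := mul_le_mul_of_nonneg_left hn hp0.le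
    refine le_trans (le_of_eq ?_) h1
    field_simp
  -- `L ≥ lam` is needed for the tail; `L ≥ ρ` makes R/L ≤ n for R = ρn.
  set L := ρ + lam with hL
  have hL0 : 0 < L := by positivity
  have hα4 : 0 < α ^ 4 := by positivity
  have hQ : ∃ Q, (ρ ^ 2 + lam ^ 2) / α ^ 4 = Q := ⟨_, rfl⟩
  obtain ⟨Q, hQ⟩ := hQ
  have hQL : L ^ 2 ≤ 2 * (α ^ 4 * Q) := by
    rw [← hQ, mul_div_cancel₀ _ hα4.ne', hL]
    nlinarith [sq_nonneg (ρ - lam)]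
  have hQ1 : 1 ≤ Q := by
    rw [← hQ, one_le_div hα4]
    have := pow_le_pow_left₀ hα2.le hρα 2
    rw [show (α ^ 2) ^ 2 = α ^ 4 by ring] at this
    linarith [sq_nonneg lam]
  obtain ⟨K', hK'⟩ : ∃ K', K / α ^ 2 = K' := ⟨_, rfl⟩
  have hK'0 : 0 < K' := by rw [← hK']; positivity
  rw [hQ, hK'] at hbig
  have b1 : 0 < K' * Λ ^ 3 := by positivity
  have b2 : 0 < K * Λ ^ 3 := by positivity
  have b3 : Λ ^ 3 ≤ Q * Λ ^ 3 := le_mul_of_one_le_left hΛ3.le hQ1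
  have b4 : 10 ^ 12 * (N (α / 2) + M + K' * Λ ^ 3 + K * Λ ^ 3 + Q * Λ ^ 3) ≤ X := by linarith
  have hXΛ : 10 ^ 11 * Λ ≤ X := by linarith
  have hXL : 10 ^ 11 * (L ^ 2 * Λ ^ 3) ≤ α ^ 4 * X := by
    have h1 := mul_le_mul_of_nonneg_right hQL hΛ3.le
    have h2 : 10 ^ 12 * (Q * Λ ^ 3) ≤ X := by linarith
    have h3 := mul_le_mul_of_nonneg_left h2 hα4.le
    have h4 : 0 ≤ α ^ 4 * (Q * Λ ^ 3) := by positivity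
    linarith
  -- the moment order and the level of the tails
  set q := ⌈Λ⌉₊ with hq
  have hq0 : 0 < q := Nat.ceil_pos.2 hΛ0
  have hqΛ : Λ ≤ q := Nat.le_ceil _
  have hq3 : (q : ℝ) ≤ 3 * Λ := by linarith [(Nat.ceil_lt_add_one hΛ0.le : (q : ℝ) < Λ + 1)]
  -- Chosen so that 2e^(-s₀) = n^(-2q), which cancels (R/L)^(2q) ≤ n^(2q).
  set s₀ := 2 * q * Real.log n + Real.log 2 with hs₀
  have hs₀0 : 0 ≤ s₀ := by positivity
  have hs₀Λ : s₀ ≤ 20 * Λ ^ 3 := by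
    have h1 : (q : ℝ) * Real.log n ≤ 3 * Λ * Λ :=
      mul_le_mul hq3 hlogn' hlogn (by positivity)
    linarith
  have hexp₀ : 2 * Real.exp (-s₀) = 1 / (n : ℝ) ^ (2 * q) := by
    have h1 : Real.exp s₀ = n ^ (2 * q) * 2 := by
      rw [hs₀, Real.exp_add, Real.exp_log (by norm_num : (0:ℝ) < 2),
        show 2 * (q : ℝ) * Real.log n = (2 * q : ℕ) * Real.log n by push_cast; ring,
        Real.exp_nat_mul, Real.exp_log (by linarith)]
    rw [Real.exp_neg, h1]
    field_simp
  have hRLn : ρ * n / L ≤ n := by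
    rw [div_le_iff₀ hL0, mul_comm]
    gcongr
    linarith
  have hRL0 : 0 ≤ ρ * n / L := by positivity
  have hRL : (ρ * n / L) ^ (2 * q) * (2 * Real.exp (-s₀)) ≤ 1 := by
    rw [hexp₀, mul_one_div, div_le_one (by positivity)]
    exact pow_le_pow_left₀ hRL0 hRLn _
  have hRL1 : ρ * n / L * (2 * Real.exp (-s₀)) ≤ 1 := by
    rw [hexp₀, mul_one_div, div_le_one (by positivity)]
    exact hRLn.trans (le_self_pow₀ hn1 (by omega))
  have hstab : ∀ m : ℕ, 9 / 10 * X ≤ m → M + K * s₀ ≤ m := fun m hm => by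
    have := mul_le_mul_of_nonneg_left hs₀Λ hK.le
    linarith
  -- the number of kept data points
  set τ := √(8 * X * Λ) with hτ
  have hτ2 : τ ^ 2 = 8 * X * Λ := Real.sq_sqrt (by positivity)
  have hτX : τ ≤ X / 10 := Real.sqrt_le_iff.2 ⟨by positivity, by
    linarith [mul_le_mul_of_nonneg_left hXΛ hX0.le, (by positivity : 0 ≤ X * Λ)]⟩
  have hτ1 : 1 ≤ τ := Real.one_le_sqrt.2 (by
    linarith [mul_le_mul_of_nonneg_left hΛ2 hX0.le])
  have hτL : 3 * L * (2 * τ) ≤ α ^ 2 / 20 * X := by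
    refine abs_le_of_sq_le_sq' ?_ (by positivity) |>.2
    have h1 := mul_le_mul_of_nonneg_left hΛΛ (sq_nonneg L)
    have h2 : 115200 * (L ^ 2 * Λ) ≤ α ^ 4 * X := by
      have : 0 ≤ L ^ 2 * Λ ^ 3 := by positivity
      linarith
    have h3 := mul_le_mul_of_nonneg_right h2 hX0.le
    calc (3 * L * (2 * τ)) ^ 2 = 36 * L ^ 2 * τ ^ 2 := by ring
      _ = 1 / 400 * (115200 * (L ^ 2 * Λ) * X) := by rw [hτ2]; ring
      _ ≤ 1 / 400 * (α ^ 4 * X * X) := by gcongr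
      _ = _ := by ring
  set m₀ := ⌈X⌉₊ with hm₀
  have hm₀1 : X ≤ m₀ := Nat.le_ceil _
  have hm₀2 : (m₀ : ℝ) < X + 1 := Nat.ceil_lt_add_one hX0.le
  set G : Set (Fin n → Bool) := {b | |(Fintype.card {i // b i = true} : ℝ) - p * n| < τ} with hG
  have hGc : (Measure.pi fun _ : Fin n => LearningTask.bern p) Gᶜ ≤ ENNReal.ofReal (β / 2) := by
    have h1 := LearningTask.measure_abs_card_sub_ge_le hp0 hp1 hn0 (τ := τ) (by positivity)
      (by linarith)
    have h2 : Gᶜ = {b | τ ≤ |(Fintype.card {i // b i = true} : ℝ) - p * n|} := by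
      ext b
      simp [hG]
    rw [h2]
    refine h1.trans (ENNReal.ofReal_le_ofReal ?_)
    have h3 : -(τ ^ 2 / (4 * (p * n))) = (2 : ℕ) * -Λ := by
      rw [hτ2, ← hX]
      field_simp
      push_cast
      ring
    rw [h3, Real.exp_nat_mul]
    have h4 : Real.exp (-Λ) ≤ β / 2 := hexpΛ.trans (by gcongr; linarith)
    calc 2 * Real.exp (-Λ) ^ 2 ≤ 2 * (β / 2) ^ 2 := by gcongr
      _ = β / 2 * β := by ring
      _ ≤ β / 2 := mul_le_of_le_one_right (by positivity) hβ1.le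
  have hfin : ENNReal.ofReal β = ENNReal.ofReal (β / 2) + ENNReal.ofReal (β / 2) := by
    rw [← ENNReal.ofReal_add (by positivity) (by positivity)]
    ring_nf
  rw [hfin]
  refine T.subsampleLaw_le hp0.le hp1 _ G (fun b hb => ?_) hGc
  set m := Fintype.card {i // b i = true} with hm
  have hb' : |(m : ℝ) - X| < τ := hb
  obtain ⟨hbl, hbr⟩ := abs_lt.1 hb'
  have hm1 : 9 / 10 * X ≤ m := by linarith
  have hm2 : m ≤ 11 / 10 * X := by linarith
  have hmpos : 0 < m := by
    have : (0 : ℝ) < m := by linarith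
    exact_mod_cast this
  have hqm : q ≤ m := by
    have : (q : ℝ) ≤ m := by linarith
    exact_mod_cast this
  -- Half of the error budget α²X/10; the other half pays for moving the mean from m to ⌈pn⌉. The
  -- threshold condition reduces to L²Λ³ ≲ α⁴X, where the cube comes from q³.
  have hdev := H.measure_truncLoss_deviation_le hmeas (L := L) (R := ρ * n) (s₀ := s₀)
    (t := α ^ 2 / 20 * X) (by linarith) (by positivity) hs₀0 hq0 hqm hRL (hstab m hm1)
    (by positivity) (by
      have h1 : (q : ℝ) ^ 3 ≤ 27 * Λ ^ 3 := by
        calc (q : ℝ) ^ 3 ≤ (3 * Λ) ^ 3 := by gcongr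
          _ = _ := by ring
      have h2 := mul_le_mul_of_nonneg_right hXL hX0.le
      calc 144 * Real.exp 9 * q ^ 3 * m * L ^ 2
          ≤ 144 * 8200 * (27 * Λ ^ 3) * (11 / 10 * X) * L ^ 2 := by
            gcongr
            exact exp_nine_le
        _ ≤ 1 / 400 * (10 ^ 11 * (L ^ 2 * Λ ^ 3) * X) := by
            have : 0 ≤ L ^ 2 * Λ ^ 3 * X := by positivity
            linarith
        _ ≤ 1 / 400 * (α ^ 4 * X * X) := by gcongr
        _ = _ := by ring)
  have hmean : |T.meanTruncLoss (ρ * n) m - T.meanTruncLoss (ρ * n) m₀| ≤ α ^ 2 / 20 * X := by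
    refine (H.abs_meanTruncLoss_sub_le hmeas (L := L) (by linarith) (by positivity) hs₀0 hRL1
      (hstab m hm1) (hstab m₀ (by linarith))).trans (le_trans ?_ hτL)
    gcongr
    exact abs_le.2 ⟨by linarith, by linarith⟩
  have hmn : m ≤ n := by
    have : (m : ℝ) ≤ n := by linarith
    exact_mod_cast this
  have hdev' : T.sampleLaw m {Z | α ^ 2 / 10 * X
      ≤ |T.truncLoss (ρ * n) Z - T.meanTruncLoss (ρ * n) m₀|} ≤ ENNReal.ofReal (β / 8) := by
    refine (measure_mono fun Z hZ => ?_).trans (hdev.trans (ENNReal.ofReal_le_ofReal ?_))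
    · have h1 := abs_sub_le (T.truncLoss (ρ * n) Z) (T.meanTruncLoss (ρ * n) m)
        (T.meanTruncLoss (ρ * n) m₀)
      have h2 : α ^ 2 / 10 * X ≤ |T.truncLoss (ρ * n) Z - T.meanTruncLoss (ρ * n) m₀| := hZ
      show α ^ 2 / 20 * X ≤ |T.truncLoss (ρ * n) Z - T.meanTruncLoss (ρ * n) m|
      linarith
    -- One factor e^(-Λ) ≤ β/(2n) absorbs the prefactor m ≤ n; the other seven are at most 1/2 each.
    · have h1 : Real.exp (-(8 * q)) ≤ β / (2 * n) * (1 / 2) ^ 7 := by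
        calc Real.exp (-(8 * q)) ≤ Real.exp ((8 : ℕ) * -Λ) := by
              gcongr
              push_cast
              linarith
          _ = Real.exp (-Λ) ^ 8 := Real.exp_nat_mul _ _
          _ = Real.exp (-Λ) * Real.exp (-Λ) ^ 7 := by ring
          _ ≤ _ := by
              gcongr
              exact hexpΛ.trans hβn2
      calc 6 * (m : ℝ) * Real.exp (-(8 * q)) ≤ 6 * n * (β / (2 * n) * (1 / 2) ^ 7) := by
            gcongr
        _ = 3 / 128 * β := by field_simp; norm_num
        _ ≤ _ := by linarith
  have htyp := H.measure_not_typical_le hα hβ hlog8 hmpos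
    (by
      have h1 : K * Λ / α ^ 2 = K' * Λ := by rw [← hK']; ring
      have h2 := mul_le_mul_of_nonneg_left hΛΛ hK'0.le
      rw [h1]
      linarith)
    (by
      have h2 := mul_le_mul_of_nonneg_left hΛΛ hK.le
      linarith)
    (by linarith) hdev'
  have := T.isProbabilityMeasure_D
  have hproj := measurePreserving_comp_injective T.D (LearningTask.keptIndex_injective b)
  -- For fixed bits the kept points have law D^m, and the preimage bound holds for outer measure, so
  -- the events need not be measurable.
  refine le_trans (le_trans (measure_mono fun Z hZ => ?_) (hproj.measure_preimage_le _)) htyp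
  intro hgood
  obtain ⟨g1, g2, g3, g4⟩ := hgood
  refine hZ fun j => ?_
  have hF : m * T.minLoss (LearningTask.full fun k => Z (LearningTask.keptIndex b k))
      ≤ 13 / 10 * X * σ ^ 2 := by
    have h1 := mul_le_mul hm2 g3 (T.minLoss_nonneg _) (by positivity)
    have h2 : 0 ≤ X * σ ^ 2 := by positivity
    linarith
  -- On the typical event the truncation is inactive.
  have hFR : T.truncLoss (ρ * n) (fun k => Z (LearningTask.keptIndex b k))
      = m * T.minLoss (LearningTask.full fun k => Z (LearningTask.keptIndex b k)) := by
    refine min_eq_left (hF.trans ?_)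
    have h1 : 13 / 10 * σ ^ 2 ≤ ρ := by linarith [sq_nonneg σ]
    calc 13 / 10 * X * σ ^ 2 = 13 / 10 * σ ^ 2 * X := by ring
      _ ≤ ρ * n := by
        gcongr
        linarith
  rw [hFR] at g4
  exact T.clippedLossOn_subsample_of_typical H.μ_pos hp0 hp hα hρ hn0 hX b Z
    (T.sum_lossBot_subsample Z b) hm1 hm2 g1 g2 hF g4 (hπ.nonempty j)
    ((Set.subset_iUnion π j).trans hπ.cover.subset)
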